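/- Let $d\ge 2$ and let $\mathcal T$ be a finite conforming partition of a bounded polytope into closed $d$-simplices (any two simplices meet in a common face or not at all), let $\Omega\subset\mathbb R^d$ be the interior of the union of all simplices, and assume that each $T\in\mathcal T$ has at least one vertex in $\Omega$. Let $\mathcal N$ and $\mathcal E$ be the sets of nodes and edges of $\mathcal T$. An edge $[i,j]\in\mathcal E$ is a boundary edge if $[i,j]\subset\partial\Omega$, and an interior edge otherwise; the set of interior edges is $\mathcal E^\circ$. Let $(\varphi_i)_{i\in\mathcal N}$ be the nodal basis of the continuous piecewise affine functions and let $\langle\cdot,\cdot\rangle$ be the $L^2(\Omega)$ pairing. For $[i,j]\in\mathcal E$ let $\omega_{i,j}$ be the union of all $T\in\mathcal T$ containing $[i,j]$ and put $$b_{i,j}=\frac{(2+d)!}{d!\,|\omega_{i,j}|}\,\varphi_i\varphi_j\,(j-i).$$ For each boundary edge $[i,j]$ choose a node $m=m(i,j)=m(j,i)\in\mathcal N\cap\Omega$ with $[i,m],[j,m]\in\mathcal E^\circ$. Put $\psi_{i,j}=b_{i,j}$ if $[i,j]\in\mathcal E^\circ$, and $\psi_{i,j}=b_{i,m}+b_{m,j}$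 if $[i,j]$ is a boundary edge. For $v\in L^1(\Omega;\mathbb R^d)$ define $$\Pi_2v=-\sum_{i\in\mathcal N}\ \sum_{j\in\mathcal N:\,[i,j]\in\mathcal E}\langle\varphi_i v,\nabla\varphi_j\rangle\,\psi_{j,i}.$$ For $A\subset\overline\Omega$ let $\omega_0(A)$ be the union of all $T'\in\mathcal T$ such that $A\cap T'$ contains a node, and $\omega_1(A)$ the union of all $T'\in\mathcal T$ such that $A\cap T'$ contains an edge. Such a choice of the nodes $m(i,j)$ exists, and for every such choice $\Pi_2$ is a well-defined linear operator from $L^1(\Omega;\mathbb R^d)$ to $\operatorname{span}\{\varphi_i\varphi_j(j-i):[i,j]\in\mathcal E^\circ\}$ with the following properties. 1. (Divergence) For every $v\in W^{1,1}_0(\Omega;\mathbb R^d)$ the function $\Pi_2v$ belongs to $W^{1,1}(\Omega;\mathbb R^d)$, and $\langle\operatorname{div}\Pi_2v,\varphi_k\rangle=\langle\operatorname{div}v,\varphi_k\rangle$ for all $k\in\mathcal N$. 2. (Local stability) There is a constant $C$, depending only on $d$ and on an upper bound $\kappa$ for the ratios of diameter to inradius of the simplices in $\mathcal T$, such that for all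 $v\in L^1(\Omega;\mathbb R^d)$ and all $T\in\mathcal T$ the following holds. If every point of $\partial\Omega$ has arbitrarily small neighbourhoods whose intersection with $\Omega$ is connected (as is the case when $\Omega$ is a Lipschitz polytope), then $$\|\Pi_2v\|_{L^\infty(T)}\le C\,\frac1{|\omega_0(T)|}\int_{\omega_0(T)}|v|\,dx.$$ If $T\cap\partial\Omega=\emptyset$, then (without this condition on $\partial\Omega$) $$\|\Pi_2v\|_{L^\infty(T)}\le C\,\frac1{|\omega_1(T)|}\int_{\omega_1(T)}|v|\,dx.$$ -/

import Mathlib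

open MeasureTheory Set Filter
open scoped Topology ContDiff ENNReal Nat

noncomputable section

namespace Fortin

/-- Euclidean space `ℝᵈ`. -/
abbrev Rd (d : ℕ) := EuclideanSpace ℝ (Fin d)

/-! ### Sobolev spaces on an open set -/

/-- `η` is a smooth function with compact support in `Ω`. -/
def IsTestFunction {d : ℕ} {F : Type*} [NormedAddCommGroup F] [NormedSpace ℝ F]
    (Ω : Set (Rd d)) (η : Rd d → F) : Prop :=
  ContDiff ℝ ∞ η ∧ HasCompactSupport η ∧ tsupport η ⊆ Ω

/-- `v ∈ W^{1,1}(Ω; ℝᵈ)`, with weak gradient `G`. -/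
structure MemW11 {d : ℕ} (Ω : Set (Rd d)) (v : Rd d → Rd d)
    (G : Rd d → Rd d →L[ℝ] Rd d) : Prop where
  integrable : IntegrableOn v Ω
  integrable_grad : IntegrableOn G Ω
  weak : ∀ η : Rd d → ℝ, IsTestFunction Ω η → ∀ e : Rd d,
    ∫ x in Ω, (fderiv ℝ η x e) • v x = - ∫ x in Ω, η x • G x e

/-- `v ∈ W^{1,1}_0(Ω; ℝᵈ)`, with weak gradient `G`: the `W^{1,1}`-closure of the test fields. -/
structure MemW110 {d : ℕ} (Ω : Set (Rd d)) (v : Rd d → Rd d)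
    (G : Rd d → Rd d →L[ℝ] Rd d) : Prop extends MemW11 Ω v G where
  approx : ∃ u : ℕ → Rd d → Rd d, (∀ n, IsTestFunction Ω (u n)) ∧
    Tendsto (fun n => ∫ x in Ω, ‖u n x - v x‖) atTop (𝓝 0) ∧
    Tendsto (fun n => ∫ x in Ω, ‖fderiv ℝ (u n) x - G x‖) atTop (𝓝 0)

/-- The divergence of a field with gradient `G`, i.e. the trace of `G`. -/
def divOf {d : ℕ} (G : Rd d → Rd d →L[ℝ] Rd d) (x : Rd d) : ℝ :=
  ∑ a : Fin d, G x (EuclideanSpace.single a 1) a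

/-! ### Meshes -/

/-- A regular (conforming) partition into `d`-simplices: a finite geometric simplicial complex in
`ℝᵈ` each of whose faces is a face of a `d`-simplex. -/
structure Mesh (d : ℕ) where
  complex : Geometry.SimplicialComplex ℝ (Rd d)
  finite : complex.faces.Finite
  pure : ∀ s ∈ complex.faces, ∃ t ∈ complex.faces, s ⊆ t ∧ t.card = d + 1

namespace Mesh

variable {d : ℕ} (M : Mesh d)

theorem finite_vertices : M.complex.vertices.Finite :=
  M.finite.preimage (f := fun x : Rd d => ({x} : Finset (Rd d)))
    (Finset.singleton_injective.injOn)

/-- The set of nodes. -/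
def nodes : Finset (Rd d) := M.finite_vertices.toFinset

/-- The `d`-simplices, each represented by its set of vertices. -/
def simplices : Set (Finset (Rd d)) := {T ∈ M.complex.faces | T.card = d + 1}

/-- The closed simplex spanned by a set of vertices. -/
def hull (T : Finset (Rd d)) : Set (Rd d) := convexHull ℝ (T : Set (Rd d))

/-- The open polytope that is partitioned by the mesh. -/
def domain : Set (Rd d) := interior M.complex.space

/-- `[i, j]` is an edge. -/
def IsEdge (i j : Rd d) : Prop :=
  open Classical in i ≠ j ∧ ({i, j} : Finset (Rd d)) ∈ M.complex.faces

/-- `[i, j]` is an edge on the boundary. -/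
def IsBoundaryEdge (i j : Rd d) : Prop :=
  M.IsEdge i j ∧ segment ℝ i j ⊆ frontier M.domain

/-- `[i, j]` is an interior edge. -/
def IsInteriorEdge (i j : Rd d) : Prop :=
  M.IsEdge i j ∧ ¬ segment ℝ i j ⊆ frontier M.domain

/-- Each `d`-simplex has at least one interior node. -/
def HasInteriorNodes : Prop := ∀ T ∈ M.simplices, ∃ i ∈ T, i ∈ M.domain

/-- Shape regularity: the ratio of the diameter of each simplex to its inradius is at most `κ`. -/
def ShapeRegular (κ : ℝ) : Prop :=
  ∀ T ∈ M.simplices, ∃ x : Rd d, ∃ r : ℝ, 0 < r ∧ Metric.closedBall x r ⊆ hull T ∧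
    Metric.diam (hull T) ≤ κ * r

/-- The polytope does not touch itself: every boundary point has arbitrarily small neighbourhoods
whose intersection with the polytope is connected. Every Lipschitz polytope has this property. -/
def BoundaryLocallyConnected : Prop :=
  ∀ x ∈ frontier M.domain, ∀ U ∈ 𝓝 x, ∃ V ∈ 𝓝 x, V ⊆ U ∧ IsPreconnected (V ∩ M.domain)

/-- `w` is the family of barycentric coordinates of `x` in a simplex of the mesh containing `x`,
extended by zero to all other points. For `x` in the closed polytope there is exactly one such `w`,
as simplices of the mesh intersect in common faces. -/
def IsBarycentric (x : Rd d) (w : Rd d → ℝ) : Prop :=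
  ∃ T ∈ M.simplices, (∀ y ∈ T, 0 ≤ w y) ∧ (∀ y ∉ T, w y = 0) ∧
    ∑ y ∈ T, w y = 1 ∧ ∑ y ∈ T, w y • y = x

open Classical in
/-- The nodal basis function `φ_i` of the continuous piecewise affine functions (extended by zero
outside of the closed polytope). -/
def phi (i x : Rd d) : ℝ :=
  if h : ∃ w, M.IsBarycentric x w then h.choose i else 0

/-- The nodal patch `ω₀(A)` of a set `A`. -/
def omega0 (A : Set (Rd d)) : Set (Rd d) :=
  ⋃ T ∈ {T ∈ M.simplices | ∃ j ∈ M.nodes, j ∈ A ∩ hull T}, hull T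

/-- The edge patch `ω₁(A)` of a set `A`. -/
def omega1 (A : Set (Rd d)) : Set (Rd d) :=
  ⋃ T ∈ {T ∈ M.simplices | ∃ i j, M.IsEdge i j ∧ segment ℝ i j ⊆ A ∩ hull T}, hull T

/-- The closed patch `ω_{i,j}` of an edge: the union of all simplices with that edge. -/
def edgePatch (i j : Rd d) : Set (Rd d) :=
  ⋃ T ∈ {T ∈ M.simplices | i ∈ T ∧ j ∈ T}, hull T

/-! ### Tangential edge bubbles and the operator `Π₂` -/

/-- The tangential bubble function `φ_i φ_j (j - i)`. -/
def bubble (i j : Rd d) : Rd d → Rd d := fun x => (M.phi i x * M.phi j x) • (j - i)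

/-- The span of the interior tangential bubble functions. -/
def edgeSpace : Submodule ℝ (Rd d → Rd d) :=
  Submodule.span ℝ {f | ∃ i j, M.IsInteriorEdge i j ∧ f = M.bubble i j}

/-- The normalized tangential bubble function `b_{i,j}`. -/
def b (i j : Rd d) : Rd d → Rd d :=
  (((2 + d)! : ℝ) / ((d ! : ℝ) * volume.real (M.edgePatch i j))) • M.bubble i j

/-- `m` chooses, for each (undirected) boundary edge `[i, j]`, an interior node `m i j` such that
`[i, m i j]` and `[j, m i j]` are interior edges. -/
def IsChoice (m : Rd d → Rd d → Rd d) : Prop :=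
  ∀ i j, M.IsBoundaryEdge i j → m i j = m j i ∧ m i j ∈ M.nodes ∧ m i j ∈ M.domain ∧
    M.IsInteriorEdge i (m i j) ∧ M.IsInteriorEdge j (m i j)

open Classical in
/-- The modified tangential bubble function `ψ_{i,j}`. -/
def psi (m : Rd d → Rd d → Rd d) (i j : Rd d) : Rd d → Rd d :=
  if M.IsBoundaryEdge i j then M.b i (m i j) + M.b (m i j) j else M.b i j

open Classical in
/-- The operator `Π_{2,i} v = - ∑_j ⟨φ_i v, ∇φ_j⟩ ψ_{j,i}`, the sum being over all `j` such that
`[i, j]` is an edge. The gradient of `φ_j` is the classical one, which exists in the interior of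
each simplex. -/
def Pi2Node (m : Rd d → Rd d → Rd d) (i : Rd d) (v : Rd d → Rd d) : Rd d → Rd d :=
  - ∑ j ∈ M.nodes with M.IsEdge i j,
    (∫ x in M.domain, inner ℝ (M.phi i x • v x) (gradient (M.phi j) x)) • M.psi m j i

/-- The divergence correcting operator `Π₂ = ∑_i Π_{2,i}`. -/
def Pi2 (m : Rd d → Rd d → Rd d) (v : Rd d → Rd d) : Rd d → Rd d :=
  ∑ i ∈ M.nodes, M.Pi2Node m i v

end Mesh

end Fortin

end

/-! Divergence. On a simplex containing `i` and `j`, the edge vector `j - i` has slope 1 against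
`φ_j` and slope -1 against `φ_i`, so the divergence of `φ_i φ_j (j - i)` is `φ_i - φ_j`. The second
moments of barycentric coordinates over `T` are `|T| / ((d+1)(d+2))`, doubled on the diagonal. Hence
testing the divergence of `b_{i,j}` with `φ_k` gives `δ_{ki} - δ_{kj}`, and the detour through `m`
in `ψ_{i,j}` telescopes to the same value (`hasDivMoments_b`, `hasDivMoments_psi`). Inserted into
`Π₂`, these leave at node `k` the term `-∑_i ⟨φ_i v, ∇φ_k⟩` and the term `∑_j ⟨φ_k v, ∇φ_j⟩`. Since
the `φ_i` sum to 1 and the `∇φ_j` to 0, the first is `-∫ v · ∇φ_k` and the second vanishes;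
integration by parts (`SegLip.integral_div`) turns the first into the moment of `div v`.

Stability. The coefficient at an edge is at most `κ / ‖j - i‖` times the integral of `|v|` over the
edge patch, and on `T` the bubbles are at most of order `diam T / |T|`. Shape regularity bounds the
number of simplices at a node, hence of contributing edges. It remains to compare `diam T` with the
length of an edge whose `ψ` does not vanish on `T`. Away from the boundary such an edge lies in `T`.
In general it may share only one vertex with `T`, and then all simplices at that vertex must have
comparable diameters. Simplices with a common edge are comparable with ratio `κ`, so it suffices to
link the simplices at a vertex through common edges (`star_connected`). If they split into two
groups without a common edge, the groups would touch only at the vertex. This is excluded at an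
interior vertex by a small connected sphere, and at a boundary vertex by the local connectedness of
the domain. -/

noncomputable section

/-! ### Barycentric coordinates of a single simplex -/

namespace Fortin

open Mesh

variable {d : ℕ}

/-- `T` is the vertex set of a non-degenerate `d`-simplex. -/
structure IsSimplex (T : Finset (Rd d)) : Prop where
  indep : AffineIndependent ℝ ((↑) : T → Rd d)
  card : T.card = d + 1

theorem IsSimplex.affineSpan_eq_top {T : Finset (Rd d)} (hT : IsSimplex T) :
    affineSpan ℝ (range ((↑) : T → Rd d)) = ⊤ := by
  rw [hT.indep.affineSpan_eq_top_iff_card_eq_finrank_add_one]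
  simp [hT.card]

/-- The affine basis given by the vertices of a simplex. -/
def IsSimplex.basis {T : Finset (Rd d)} (hT : IsSimplex T) : AffineBasis T ℝ (Rd d) :=
  ⟨(↑), hT.indep, hT.affineSpan_eq_top⟩

open Classical in
/-- The barycentric coordinate of the vertex `k` in the simplex `T`, as an affine function on the
whole space, and zero if `k` is not a vertex. -/
def bary (T : Finset (Rd d)) (k : Rd d) : Rd d →ᵃ[ℝ] ℝ :=
  if h : IsSimplex T ∧ k ∈ T then h.1.basis.coord ⟨k, h.2⟩ else 0

/-- The linear part of a barycentric coordinate. -/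
def baryGrad (T : Finset (Rd d)) (k : Rd d) : Rd d →L[ℝ] ℝ :=
  LinearMap.toContinuousLinearMap (bary T k).linear

theorem bary_of_notMem {T : Finset (Rd d)} {k : Rd d} (hk : k ∉ T) : bary T k = 0 :=
  dif_neg fun h => hk h.2

theorem baryGrad_of_notMem {T : Finset (Rd d)} {k : Rd d} (hk : k ∉ T) : baryGrad T k = 0 := by
  ext x
  simp [baryGrad, bary_of_notMem hk]

theorem bary_add (T : Finset (Rd d)) (k x w : Rd d) :
    bary T k (x + w) = bary T k x + baryGrad T k w := by
  have := (bary T k).map_vadd x w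
  simp only [vadd_eq_add] at this
  rw [add_comm x w, this, add_comm]
  rfl

theorem bary_sub_bary (T : Finset (Rd d)) (k x y : Rd d) :
    bary T k x - bary T k y = baryGrad T k (x - y) := by
  have := bary_add T k y (x - y)
  rw [add_sub_cancel] at this
  linarith

theorem hasFDerivAt_bary (T : Finset (Rd d)) (k x : Rd d) :
    HasFDerivAt (bary T k) (baryGrad T k) x := by
  have h : (bary T k : Rd d → ℝ) = fun y => bary T k x + baryGrad T k (y - x) := by
    funext y
    rw [← bary_sub_bary]
    ring
  rw [h]
  exact ((baryGrad T k).hasFDerivAt.comp x ((hasFDerivAt_id x).sub_const x)).const_add _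

theorem continuous_bary (T : Finset (Rd d)) (k : Rd d) : Continuous (bary T k) :=
  continuous_iff_continuousAt.2 fun x => (hasFDerivAt_bary T k x).continuousAt

namespace IsSimplex

variable {T : Finset (Rd d)} (hT : IsSimplex T)
include hT

theorem bary_eq_coord {k : Rd d} (hk : k ∈ T) : bary T k = hT.basis.coord ⟨k, hk⟩ :=
  dif_pos ⟨hT, hk⟩

theorem bary_self {k : Rd d} (hk : k ∈ T) : bary T k k = 1 := by
  rw [hT.bary_eq_coord hk]
  exact hT.basis.coord_apply_eq ⟨k, hk⟩

theorem bary_ne {k l : Rd d} (hl : l ∈ T) (hkl : k ≠ l) : bary T k l = 0 := by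
  by_cases hk : k ∈ T
  · rw [hT.bary_eq_coord hk]
    exact hT.basis.coord_apply_ne (i := ⟨k, hk⟩) (j := ⟨l, hl⟩) (by simpa using hkl)
  · simp [bary_of_notMem hk]

theorem sum_bary (x : Rd d) : ∑ k ∈ T, bary T k x = 1 := by
  rw [← hT.basis.sum_coord_apply_eq_one x, ← Finset.sum_coe_sort]
  exact Finset.sum_congr rfl fun k _ => by rw [hT.bary_eq_coord k.2]

theorem sum_bary_smul (x : Rd d) : ∑ k ∈ T, bary T k x • k = x := by
  conv_rhs => rw [← hT.basis.linear_combination_coord_eq_self x]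
  rw [← Finset.sum_coe_sort]
  exact Finset.sum_congr rfl fun k _ => by rw [hT.bary_eq_coord k.2]; rfl

/-- An affine function commutes with combinations of total weight 1, and the coordinate of `k` is 1
at `k` and 0 at the other vertices. -/
theorem eq_bary {w : Rd d → ℝ} {x : Rd d} (h1 : ∑ y ∈ T, w y = 1)
    (h2 : ∑ y ∈ T, w y • y = x) {k : Rd d} (hk : k ∈ T) : w k = bary T k x := by
  have h0 : ∀ y, bary T k y = bary T k 0 + baryGrad T k y := fun y => by
    simpa using bary_add T k 0 y
  rw [h0, ← h2, map_sum]
  have : bary T k 0 = ∑ y ∈ T, w y * bary T k 0 := by rw [← Finset.sum_mul, h1, one_mul]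
  rw [this, ← Finset.sum_add_distrib]
  have h3 : ∀ y ∈ T, w y * bary T k 0 + baryGrad T k (w y • y) = if y = k then w k else 0 := by
    intro y hy
    rw [map_smul, smul_eq_mul, ← mul_add, ← h0]
    split_ifs with h
    · rw [h, hT.bary_self hk, mul_one]
    · rw [hT.bary_ne hy (Ne.symm h), mul_zero]
  rw [Finset.sum_congr rfl h3]
  simp [hk]

theorem mem_hull_iff {x : Rd d} : x ∈ hull T ↔ ∀ k ∈ T, 0 ≤ bary T k x := by
  have h : hull T = convexHull ℝ (range hT.basis) := by
    have : range hT.basis = (T : Set (Rd d)) := Subtype.range_coe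
    rw [this, hull]
  rw [h, hT.basis.convexHull_eq_nonneg_coord]
  constructor
  · intro hx k hk
    rw [hT.bary_eq_coord hk]
    exact hx ⟨k, hk⟩
  · intro hx k
    have := hx k.1 k.2
    rwa [hT.bary_eq_coord k.2] at this

theorem interior_hull_nonempty : (interior (hull T)).Nonempty := by
  rw [hull, interior_convexHull_nonempty_iff_affineSpan_eq_top]
  have := hT.affineSpan_eq_top
  rwa [Subtype.range_coe] at this

theorem bary_nonneg {x : Rd d} (hx : x ∈ hull T) (k : Rd d) : 0 ≤ bary T k x := by
  by_cases hk : k ∈ T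
  · exact hT.mem_hull_iff.1 hx k hk
  · simp [bary_of_notMem hk]

theorem bary_le_one {x : Rd d} (hx : x ∈ hull T) (k : Rd d) : bary T k x ≤ 1 := by
  by_cases hk : k ∈ T
  · rw [← hT.sum_bary x]
    exact Finset.single_le_sum (fun l _ => hT.bary_nonneg hx l) hk
  · simp [bary_of_notMem hk]

theorem baryGrad_edge {i j : Rd d} (hi : i ∈ T) (hj : j ∈ T) (k : Rd d) :
    baryGrad T k (j - i) = (if k = j then 1 else 0) - (if k = i then 1 else 0) := by
  rw [← bary_sub_bary]
  congr 1
  · split_ifs with h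
    · rw [h, hT.bary_self hj]
    · exact hT.bary_ne hj h
  · split_ifs with h
    · rw [h, hT.bary_self hi]
    · exact hT.bary_ne hi h

theorem ext_bary {x y : Rd d} (h : ∀ k ∈ T, bary T k x = bary T k y) : x = y := by
  rw [← hT.sum_bary_smul x, ← hT.sum_bary_smul y]
  exact Finset.sum_congr rfl fun k hk => by rw [h k hk]

end IsSimplex

theorem convex_hull (T : Finset (Rd d)) : Convex ℝ (hull T) := convex_convexHull ℝ _

theorem isCompact_hull (T : Finset (Rd d)) : IsCompact (hull T) :=
  T.finite_toSet.isCompact_convexHull (𝕜 := ℝ)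

theorem isClosed_hull (T : Finset (Rd d)) : IsClosed (hull T) := (isCompact_hull T).isClosed

theorem mem_hull {T : Finset (Rd d)} {k : Rd d} (hk : k ∈ T) : k ∈ hull T :=
  subset_convexHull ℝ _ hk

theorem volume_frontier_hull (T : Finset (Rd d)) : volume (frontier (hull T)) = 0 :=
  (convex_hull T).addHaar_frontier volume

theorem IsSimplex.volume_hull_pos {T : Finset (Rd d)} (hT : IsSimplex T) :
    0 < volume.real (hull T) := by
  rw [Measure.real, ENNReal.toReal_pos_iff]
  exact ⟨(isOpen_interior.measure_pos volume hT.interior_hull_nonempty).trans_le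
    (measure_mono interior_subset), (isCompact_hull T).measure_lt_top⟩

/-- The zero set of a non-zero affine function is a null set. -/
theorem volume_affine_zero_set (f : Rd d →ᵃ[ℝ] ℝ) {p : Rd d} (hp : f p ≠ 0) :
    volume {x | f x = 0} = 0 := by
  have h := Measure.addHaar_affineSubspace volume
    ((AffineSubspace.mk' (0 : ℝ) (⊥ : Submodule ℝ ℝ)).comap f) ?_
  · convert h using 2
    ext x
    simp [AffineSubspace.mem_mk']
  · intro h
    have : p ∈ (AffineSubspace.mk' (0 : ℝ) (⊥ : Submodule ℝ ℝ)).comap f := by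
      rw [h]; trivial
    simp [AffineSubspace.mem_comap, AffineSubspace.mem_mk'] at this
    exact hp this

end Fortin

/-! ### Second moments of barycentric coordinates, by affine symmetries -/

namespace Fortin

open Mesh

variable {d : ℕ}

/-- The affine map `x ↦ x + f x • w`. -/
def shear (f : Rd d → ℝ) (w x : Rd d) : Rd d := x + f x • w

/-- Change of variables for shears along affine functions: the Jacobian is constant. -/
theorem exists_integral_image_shear (f : Rd d → ℝ) (f' : Rd d →L[ℝ] ℝ) (w : Rd d)
    (hf : ∀ x, HasFDerivAt f f' x) (hinj : Function.Injective (shear f w)) :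
    ∃ α : ℝ, ∀ s : Set (Rd d), MeasurableSet s → ∀ g : Rd d → ℝ,
      ∫ x in shear f w '' s, g x = α * ∫ x in s, g (shear f w x) := by
  refine ⟨|(ContinuousLinearMap.id ℝ (Rd d) + f'.smulRight w).det|, fun s hs g => ?_⟩
  have hder : ∀ x ∈ s, HasFDerivWithinAt (shear f w)
      (ContinuousLinearMap.id ℝ (Rd d) + f'.smulRight w) s x := fun x _ =>
    ((hasFDerivAt_id x).add ((hf x).smul_const w)).hasFDerivWithinAt
  rw [integral_image_eq_integral_abs_det_fderiv_smul volume hs hder hinj.injOn]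
  simp only [smul_eq_mul]
  rw [integral_const_mul]

theorem bary_shear (T : Finset (Rd d)) (f : Rd d → ℝ) (w x k : Rd d) :
    bary T k (shear f w x) = bary T k x + f x * baryGrad T k w := by
  rw [shear, bary_add, map_smul, smul_eq_mul]

theorem continuous_integrableOn_hull {g : Rd d → ℝ} (hg : Continuous g) (T : Finset (Rd d)) :
    IntegrableOn g (hull T) :=
  hg.continuousOn.integrableOn_compact (isCompact_hull T)

namespace IsSimplex

variable {T : Finset (Rd d)} (hT : IsSimplex T) {i j : Rd d} (hi : i ∈ T) (hj : j ∈ T)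
  (hij : i ≠ j)
include hT hi hj hij

/-- The half of the simplex that is closer to the vertex `i` than to `j`. -/
theorem image_half : shear (fun x => bary T j x / 2) (i - j) '' hull T =
    {x ∈ hull T | bary T j x ≤ bary T i x} := by
  have key : ∀ (f : Rd d → ℝ) (x k : Rd d), bary T k (shear f (i - j) x) =
      bary T k x + f x * ((if k = i then 1 else 0) - (if k = j then 1 else 0)) := by
    intro f x k
    rw [bary_shear, hT.baryGrad_edge hj hi]
  ext y
  constructor
  · rintro ⟨x, hx, rfl⟩
    have h1 := hT.bary_nonneg hx
    refine ⟨hT.mem_hull_iff.2 fun k hk => ?_, ?_⟩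
    · rw [key]
      by_cases hki : k = i
      · subst hki; simp only [if_true, hij, if_false]; linarith [h1 k, h1 j]
      · by_cases hkj : k = j
        · subst hkj; simp only [if_true, hij.symm, if_false]; linarith [h1 k]
        · simpa [hki, hkj] using h1 k
    · rw [key, key]
      simp only [if_true, hij, hij.symm, if_false]; linarith [h1 i]
  · rintro ⟨hy, hle⟩
    have h1 := hT.bary_nonneg hy
    -- The shear has halved the coordinate of `j`, so its inverse subtracts the full coordinate of
    -- the image point. The coordinate of `i` stays non-negative exactly because of `hle`.
    refine ⟨shear (fun x => - bary T j x) (i - j) y, hT.mem_hull_iff.2 fun k hk => ?_, ?_⟩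
    · rw [key]
      by_cases hki : k = i
      · subst hki; simp only [if_true, hij, if_false]; linarith [h1 k, h1 j]
      · by_cases hkj : k = j
        · subst hkj; simp only [if_true, hij.symm, if_false]; linarith [h1 k]
        · simpa [hki, hkj] using h1 k
    · refine hT.ext_bary fun k hk => ?_
      rw [key, key, key]
      simp only [if_true, hij.symm, if_false]
      ring

/-- Moving by `λ_i - λ_j` along the edge exchanges these two coordinates and fixes the others: this
is the affine involution that transposes two vertices. -/
theorem bary_swap (x k : Rd d) :
    bary T k (shear (fun x => bary T i x - bary T j x) (j - i) x) =
      bary T (Equiv.swap i j k) x := by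
  rw [bary_shear, hT.baryGrad_edge hi hj]
  by_cases hki : k = i
  · subst hki; rw [Equiv.swap_apply_left]; simp [hij]
  · by_cases hkj : k = j
    · subst hkj; rw [Equiv.swap_apply_right]; simp [hij.symm]
    · rw [Equiv.swap_apply_of_ne_of_ne hki hkj]; simp [hki, hkj]

theorem swap_swap (x : Rd d) :
    shear (fun x => bary T i x - bary T j x) (j - i)
      (shear (fun x => bary T i x - bary T j x) (j - i) x) = x :=
  hT.ext_bary fun k _ => by
    rw [hT.bary_swap hi hj hij, hT.bary_swap hi hj hij, Equiv.swap_apply_self]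

theorem swap_mem_hull {x : Rd d} (hx : x ∈ hull T) :
    shear (fun x => bary T i x - bary T j x) (j - i) x ∈ hull T :=
  hT.mem_hull_iff.2 fun k _ => by
    rw [hT.bary_swap hi hj hij]; exact hT.bary_nonneg hx _

theorem image_swap_hull :
    shear (fun x => bary T i x - bary T j x) (j - i) '' hull T = hull T := by
  refine Subset.antisymm ?_ fun x hx => ⟨_, hT.swap_mem_hull hi hj hij hx,
    hT.swap_swap hi hj hij x⟩
  rintro _ ⟨x, hx, rfl⟩
  exact hT.swap_mem_hull hi hj hij hx

/-- Swapping two vertices of a simplex preserves the volume. -/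
theorem integral_image_swap {s : Set (Rd d)} (hs : MeasurableSet s) (g : Rd d → ℝ) :
    ∫ x in shear (fun x => bary T i x - bary T j x) (j - i) '' s, g x =
      ∫ x in s, g (shear (fun x => bary T i x - bary T j x) (j - i) x) := by
  obtain ⟨α, hα⟩ := exists_integral_image_shear (fun x => bary T i x - bary T j x)
    (baryGrad T i - baryGrad T j) (j - i)
    (fun x => (hasFDerivAt_bary T i x).sub (hasFDerivAt_bary T j x))
    (Function.LeftInverse.injective (hT.swap_swap hi hj hij))
  -- The Jacobian need not be computed: the simplex is mapped onto itself and has positive finite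
  -- volume, so the constant is 1.
  have h1 := hα (hull T) (isClosed_hull T).measurableSet fun _ => 1
  rw [hT.image_swap_hull hi hj hij] at h1
  have hV := hT.volume_hull_pos
  have hα1 : α = 1 := by
    simp only [integral_const, MeasurableSet.univ, measureReal_restrict_apply, univ_inter,
      smul_eq_mul, mul_one] at h1
    nlinarith
  rw [hα s hs g, hα1, one_mul]

/-- The transposition of `i` and `j` exchanges the two halves, which overlap only in the hyperplane
where both coordinates agree. -/
theorem integral_hull_eq_two_halves {g : Rd d → ℝ} (hg : Continuous g)
    (hgs : ∀ x, g (shear (fun x => bary T i x - bary T j x) (j - i) x) = g x) :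
    ∫ x in hull T, g x = 2 * ∫ x in {x ∈ hull T | bary T j x ≤ bary T i x}, g x := by
  set A := {x ∈ hull T | bary T j x ≤ bary T i x} with hA
  set B := {x ∈ hull T | bary T i x ≤ bary T j x} with hB
  have hAc : IsClosed A := (isClosed_hull T).inter
    (isClosed_le (continuous_bary T j) (continuous_bary T i))
  have hBc : IsClosed B := (isClosed_hull T).inter
    (isClosed_le (continuous_bary T i) (continuous_bary T j))
  have hAB : A ∪ B = hull T := by
    ext x
    simp only [hA, hB, mem_union, mem_ofPred_eq, ← and_or_left]
    exact and_iff_left (le_total _ _)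
  have himg : shear (fun x => bary T i x - bary T j x) (j - i) '' A = B := by
    ext x
    constructor
    · rintro ⟨x, ⟨hx, hle⟩, rfl⟩
      refine ⟨hT.swap_mem_hull hi hj hij hx, ?_⟩
      rw [hT.bary_swap hi hj hij, hT.bary_swap hi hj hij, Equiv.swap_apply_left,
        Equiv.swap_apply_right]
      exact hle
    · rintro ⟨hx, hle⟩
      refine ⟨_, ⟨hT.swap_mem_hull hi hj hij hx, ?_⟩, hT.swap_swap hi hj hij x⟩
      rw [hT.bary_swap hi hj hij, hT.bary_swap hi hj hij, Equiv.swap_apply_left,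
        Equiv.swap_apply_right]
      exact hle
  have hnull : AEDisjoint volume A B := by
    refine measure_mono_null (t := {x | (bary T i - bary T j) x = 0}) ?_
      (volume_affine_zero_set _ (p := i) ?_)
    · rintro x ⟨hxA, hxB⟩
      have := le_antisymm hxA.2 hxB.2
      simp [this]
    · simp [hT.bary_self hi, hT.bary_ne hi hij.symm]
  rw [← hAB, setIntegral_union₀ hnull hBc.measurableSet.nullMeasurableSet
    ((continuous_integrableOn_hull hg T).mono_set (hAB ▸ subset_union_left))
    ((continuous_integrableOn_hull hg T).mono_set (hAB ▸ subset_union_right)), ← himg,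
    hT.integral_image_swap hi hj hij hAc.measurableSet]
  simp only [hgs]
  ring

theorem integral_bary_sq_eq : ∫ x in hull T, bary T j x ^ 2 = ∫ x in hull T, bary T i x ^ 2 := by
  have h := hT.integral_image_swap hi hj hij (isClosed_hull T).measurableSet
    fun x => bary T j x ^ 2
  rw [hT.image_swap_hull hi hj hij] at h
  simpa [hT.bary_swap hi hj hij] using h

/-- The integrand is symmetric in `i` and `j`, so half the simplex carries half the integral.
Shifting half of the `j`-coordinate to `i` maps the whole simplex onto that half with Jacobian 1/2,
and pulls `λ_i - λ_j` back to `λ_i`. -/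
theorem integral_sub_sq :
    ∫ x in hull T, (bary T i x - bary T j x) ^ 2 = ∫ x in hull T, bary T i x ^ 2 := by
  have hhalf := hT.image_half hi hj hij
  have key : ∀ (f : Rd d → ℝ) (x k : Rd d), bary T k (shear f (i - j) x) =
      bary T k x + f x * ((if k = i then 1 else 0) - (if k = j then 1 else 0)) := by
    intro f x k
    rw [bary_shear, hT.baryGrad_edge hj hi]
  have hinj : Function.Injective (shear (fun x => bary T j x / 2) (i - j)) := by
    intro x y hxy
    have hj' : bary T j x = bary T j y := by
      have := congrArg (bary T j) hxy
      rw [key, key] at this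
      simp only [if_true, hij.symm, if_false] at this
      linarith
    simp only [shear, hj'] at hxy
    exact add_right_cancel hxy
  obtain ⟨α, hα⟩ := exists_integral_image_shear (fun x => bary T j x / 2)
    ((2 : ℝ)⁻¹ • baryGrad T j) (i - j) (fun x => by
      have := (hasFDerivAt_bary T j x).const_mul (2 : ℝ)⁻¹
      simpa only [div_eq_inv_mul] using this) hinj
  have h1 := hα (hull T) (isClosed_hull T).measurableSet fun _ => 1
  have h2 := hα (hull T) (isClosed_hull T).measurableSet fun x => (bary T i x - bary T j x) ^ 2
  have h3 := hT.integral_hull_eq_two_halves hi hj hij (g := fun _ => 1) continuous_const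
    fun _ => rfl
  have h4 := hT.integral_hull_eq_two_halves hi hj hij
    (g := fun x => (bary T i x - bary T j x) ^ 2)
    (((continuous_bary T i).sub (continuous_bary T j)).pow 2) fun x => by
      rw [hT.bary_swap hi hj hij, hT.bary_swap hi hj hij, Equiv.swap_apply_left,
        Equiv.swap_apply_right]
      ring
  rw [← hhalf, h1] at h3
  rw [← hhalf, h2] at h4
  have hV := hT.volume_hull_pos
  have hα1 : 2 * α = 1 := by
    simp only [integral_const, MeasurableSet.univ, measureReal_restrict_apply, univ_inter,
      smul_eq_mul, mul_one] at h3
    nlinarith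
  rw [h4, ← mul_assoc, hα1, one_mul]
  congr 1
  funext x
  rw [key, key]
  simp only [if_true, hij, hij.symm, if_false]
  ring

/-- Expanding the square in `integral_sub_sq` reads `A + A - 2B = A`. -/
theorem integral_sq_eq_two_mul :
    ∫ x in hull T, bary T i x ^ 2 = 2 * ∫ x in hull T, bary T i x * bary T j x := by
  have h := hT.integral_sub_sq hi hj hij
  have h' := hT.integral_bary_sq_eq hi hj hij
  have ci := continuous_bary T i
  have cj := continuous_bary T j
  have e : ∀ x, (bary T i x - bary T j x) ^ 2 =
      (bary T i x ^ 2 + bary T j x ^ 2) - 2 * (bary T i x * bary T j x) := fun x => by ring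
  simp only [e] at h
  rw [integral_sub (continuous_integrableOn_hull (by fun_prop) T)
    (continuous_integrableOn_hull (by fun_prop) T),
    integral_add (continuous_integrableOn_hull (by fun_prop) T)
    (continuous_integrableOn_hull (by fun_prop) T), integral_const_mul, h'] at h
  linarith

end IsSimplex

/-- The second moments of the barycentric coordinates. -/
theorem IsSimplex.integral_bary_sq {T : Finset (Rd d)} (hT : IsSimplex T) {i : Rd d}
    (hi : i ∈ T) :
    ∫ x in hull T, bary T i x * bary T i x =
      2 * volume.real (hull T) / ((d + 1) * (d + 2)) := by
  classical
  set A := ∫ x in hull T, bary T i x * bary T i x with hA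
  have hsq : ∀ k ∈ T, ∫ x in hull T, bary T k x * bary T k x = A := by
    intro k hk
    by_cases hki : k = i
    · rw [hki]
    · simpa only [hA, ← pow_two] using hT.integral_bary_sq_eq hi hk (Ne.symm hki)
  have hprod : ∀ k ∈ T, ∀ l ∈ T, ∫ x in hull T, bary T k x * bary T l x =
      A / 2 + if l = k then A / 2 else 0 := by
    intro k hk l hl
    by_cases hkl : l = k
    · rw [hkl, hsq k hk]; simp
    · have := hT.integral_sq_eq_two_mul hk hl (Ne.symm hkl)
      simp only [pow_two, hsq k hk] at this
      simp only [hkl, if_false]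
      linarith
  have hcont := continuous_bary T
  -- Integrating the square of `∑ λ_k = 1` expresses the volume by the single unknown `A`: each of
  -- the `d + 1` rows contributes `(d + 2) A / 2`.
  have hV : volume.real (hull T) = ∑ k ∈ T, ∑ l ∈ T, ∫ x in hull T, bary T k x * bary T l x := by
    have h1 : volume.real (hull T) =
        ∫ x in hull T, ∑ k ∈ T, ∑ l ∈ T, bary T k x * bary T l x := by
      simp_rw [← Finset.mul_sum, hT.sum_bary, mul_one, hT.sum_bary]
      simp
    rw [h1, integral_finsetSum]
    · refine Finset.sum_congr rfl fun k _ => ?_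
      rw [integral_finsetSum]
      exact fun l _ => continuous_integrableOn_hull (by fun_prop) T
    · exact fun k _ => continuous_integrableOn_hull (by fun_prop) T
  rw [Finset.sum_congr rfl fun k hk => Finset.sum_congr rfl fun l hl => hprod k hk l hl] at hV
  have h2 : ∀ k ∈ T, ∑ l ∈ T, (A / 2 + if l = k then A / 2 else 0) = (d + 2) * (A / 2) := by
    intro k hk
    rw [Finset.sum_add_distrib, Finset.sum_ite_eq' T k]
    simp [hk, hT.card]
    ring
  rw [Finset.sum_congr rfl h2, Finset.sum_const, hT.card, nsmul_eq_mul] at hV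
  push_cast at hV
  rw [hV]
  field_simp

theorem IsSimplex.integral_bary_mul {T : Finset (Rd d)} (hT : IsSimplex T) {i j : Rd d}
    (hi : i ∈ T) (hj : j ∈ T) (hij : i ≠ j) :
    ∫ x in hull T, bary T i x * bary T j x = volume.real (hull T) / ((d + 1) * (d + 2)) := by
  have h := hT.integral_sq_eq_two_mul hi hj hij
  simp only [pow_two] at h
  rw [hT.integral_bary_sq hi] at h
  have : (2 : ℝ) * volume.real (hull T) / ((d + 1) * (d + 2)) =
    2 * (volume.real (hull T) / ((d + 1) * (d + 2))) := by ring
  linarith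

end Fortin

/-! ### The nodal basis, almost disjoint simplices, and edges of a mesh -/

namespace Fortin

/-- The integral over an almost everywhere disjoint finite union. -/
theorem integral_biUnion_finset_ae {X ι : Type*} [MeasurableSpace X] {μ : Measure X} {f : X → ℝ}
    (t : Finset ι) {s : ι → Set X} (hs : ∀ i ∈ t, MeasurableSet (s i))
    (hd : (t : Set ι).Pairwise (Function.onFun (AEDisjoint μ) s))
    (hf : ∀ i ∈ t, IntegrableOn f (s i) μ) :
    ∫ x in ⋃ i ∈ t, s i, f x ∂μ = ∑ i ∈ t, ∫ x in s i, f x ∂μ := by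
  classical
  induction t using Finset.induction_on with
  | empty => simp
  | insert a t hat ih =>
    simp only [Finset.coe_insert, Finset.forall_mem_insert, Finset.set_biUnion_insert] at hs hd hf ⊢
    have hdis : AEDisjoint μ (s a) (⋃ i ∈ t, s i) := by
      rw [AEDisjoint, inter_iUnion₂]
      refine (measure_biUnion_null_iff t.countable_toSet).2 fun i hi => ?_
      exact hd (mem_insert _ _) (mem_insert_of_mem _ hi) fun h => hat (h ▸ hi)
    rw [setIntegral_union₀ hdis (t.measurableSet_biUnion hs.2).nullMeasurableSet hf.1
      (integrableOn_finset_iUnion.2 hf.2), Finset.sum_insert hat,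
      ih hs.2 (hd.mono (subset_insert _ _)) hf.2]

namespace Mesh

variable {d : ℕ} (M : Mesh d)

variable {M} in
theorem isSimplex {T : Finset (Rd d)} (hT : T ∈ M.simplices) : IsSimplex T :=
  ⟨M.complex.indep hT.1, hT.2⟩

theorem finite_simplices : M.simplices.Finite := M.finite.subset fun _ h => h.1

/-- The finite set of `d`-simplices. -/
def elements : Finset (Finset (Rd d)) := M.finite_simplices.toFinset

variable {M} in
@[simp]
theorem mem_elements {T : Finset (Rd d)} : T ∈ M.elements ↔ T ∈ M.simplices := by
  simp [elements]

variable {M}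

theorem mem_nodes_iff {k : Rd d} : k ∈ M.nodes ↔ ∃ T ∈ M.simplices, k ∈ T := by
  rw [nodes, Set.Finite.mem_toFinset]
  constructor
  · intro h
    obtain ⟨T, hT, hk, hc⟩ := M.pure _ h
    exact ⟨T, ⟨hT, hc⟩, hk (Finset.mem_singleton_self k)⟩
  · rintro ⟨T, hT, hk⟩
    exact M.complex.down_closed hT.1 (Finset.singleton_subset_iff.2 hk)
      (Finset.singleton_nonempty k)

theorem mem_of_mem_hull {k : Rd d} {T : Finset (Rd d)} (hk : k ∈ M.nodes)
    (hT : T ∈ M.simplices) (h : k ∈ hull T) : k ∈ T :=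
  (Geometry.SimplicialComplex.vertex_mem_convexHull_iff
    ((M.finite_vertices.mem_toFinset).1 hk) hT.1).1 h

theorem space_eq : M.complex.space = ⋃ T ∈ M.elements, hull T := by
  ext x
  simp only [Geometry.SimplicialComplex.mem_space_iff, mem_iUnion, exists_prop, mem_elements]
  constructor
  · rintro ⟨s, hs, hx⟩
    obtain ⟨t, ht, hst, hc⟩ := M.pure s hs
    exact ⟨t, ⟨ht, hc⟩, convexHull_mono (by exact_mod_cast hst) hx⟩
  · rintro ⟨T, hT, hx⟩
    exact ⟨T, hT.1, hx⟩

theorem hull_subset_space {T : Finset (Rd d)} (hT : T ∈ M.simplices) :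
    hull T ⊆ M.complex.space :=
  Geometry.SimplicialComplex.convexHull_subset_space hT.1

theorem exists_mem_hull {x : Rd d} (hx : x ∈ M.complex.space) :
    ∃ T ∈ M.simplices, x ∈ hull T := by
  rw [space_eq] at hx
  simpa using hx

theorem isCompact_space : IsCompact M.complex.space := by
  rw [space_eq]
  exact M.elements.isCompact_biUnion fun T _ => isCompact_hull T

theorem domain_subset_space : M.domain ⊆ M.complex.space := interior_subset

theorem isOpen_domain : IsOpen M.domain := isOpen_interior

theorem interior_hull_subset_domain {T : Finset (Rd d)} (hT : T ∈ M.simplices) :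
    interior (hull T) ⊆ M.domain :=
  interior_mono (hull_subset_space hT)

theorem volume_domain_lt_top : volume M.domain < ⊤ :=
  (measure_mono domain_subset_space).trans_lt isCompact_space.measure_lt_top

instance : IsFiniteMeasure (volume.restrict M.domain) :=
  isFiniteMeasure_restrict.2 volume_domain_lt_top.ne

/-- Barycentric coordinates in different simplices agree on the intersection. -/
theorem bary_eq_bary {T T' : Finset (Rd d)} (hT : T ∈ M.simplices) (hT' : T' ∈ M.simplices)
    {x : Rd d} (hx : x ∈ hull T) (hx' : x ∈ hull T') (k : Rd d) :
    bary T k x = bary T' k x := by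
  classical
  have h := M.complex.inter_subset_convexHull hT.1 hT'.1 ⟨hx, hx'⟩
  rw [← Finset.coe_inter, Finset.mem_convexHull'] at h
  obtain ⟨w, -, h1, h2⟩ := h
  -- Conformity places `x` in the hull of the common vertices. Weights there, extended by zero, are
  -- barycentric coordinates for both simplices, which are unique by `eq_bary`.
  set w' : Rd d → ℝ := fun y => if y ∈ T ∩ T' then w y else 0 with hw'
  have hsum : ∀ S : Finset (Rd d), T ∩ T' ⊆ S →
      ∑ y ∈ S, w' y = 1 ∧ ∑ y ∈ S, w' y • y = x := by
    intro S hS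
    constructor
    · rw [← h1, ← Finset.sum_subset hS]
      · exact Finset.sum_congr rfl fun y hy => by simp only [hw', if_pos hy]
      · exact fun y _ hy => by simp only [hw', if_neg hy]
    · rw [← h2, ← Finset.sum_subset hS]
      · exact Finset.sum_congr rfl fun y hy => by simp only [hw', if_pos hy]
      · exact fun y _ hy => by simp only [hw', if_neg hy, zero_smul]
  have key : ∀ S : Finset (Rd d), IsSimplex S → T ∩ T' ⊆ S → bary S k x = w' k := by
    intro S hS hsub
    by_cases hk : k ∈ S
    · exact (hS.eq_bary (hsum S hsub).1 (hsum S hsub).2 hk).symm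
    · rw [bary_of_notMem hk]
      simp only [hw', if_neg fun h => hk (hsub h)]
      rfl
  rw [key T (isSimplex hT) Finset.inter_subset_left,
    key T' (isSimplex hT') Finset.inter_subset_right]

/-- The definition picks an arbitrary simplex containing `x`; by `bary_eq_bary` the pick does not
matter. All later work with `phi` passes through this identity. -/
theorem phi_eq_bary {T : Finset (Rd d)} (hT : T ∈ M.simplices) {x : Rd d} (hx : x ∈ hull T)
    (k : Rd d) : M.phi k x = bary T k x := by
  have hS := isSimplex hT
  have hex : ∃ w, M.IsBarycentric x w :=
    ⟨fun y => bary T y x, T, hT, fun y _ => hS.bary_nonneg hx y,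
      fun y hy => by simp [bary_of_notMem hy], hS.sum_bary x, hS.sum_bary_smul x⟩
  rw [phi, dif_pos hex]
  obtain ⟨T', hT', h0, hn, h1, h2⟩ := hex.choose_spec
  set w := hex.choose
  have hx' : x ∈ hull T' := by
    rw [hull, Finset.mem_convexHull']
    exact ⟨w, h0, h1, h2⟩
  rw [bary_eq_bary hT hT' hx hx']
  by_cases hk : k ∈ T'
  · exact (isSimplex hT').eq_bary h1 h2 hk
  · simp [hn k hk, bary_of_notMem hk]

theorem phi_nonneg {x : Rd d} (hx : x ∈ M.complex.space) (k : Rd d) : 0 ≤ M.phi k x := by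
  obtain ⟨T, hT, hxT⟩ := exists_mem_hull hx
  rw [phi_eq_bary hT hxT]
  exact (isSimplex hT).bary_nonneg hxT k

theorem phi_le_one {x : Rd d} (hx : x ∈ M.complex.space) (k : Rd d) : M.phi k x ≤ 1 := by
  obtain ⟨T, hT, hxT⟩ := exists_mem_hull hx
  rw [phi_eq_bary hT hxT]
  exact (isSimplex hT).bary_le_one hxT k

theorem abs_phi_le_one {x : Rd d} (hx : x ∈ M.complex.space) (k : Rd d) : |M.phi k x| ≤ 1 :=
  abs_le.2 ⟨by linarith [phi_nonneg hx k], phi_le_one hx k⟩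

theorem sum_phi {x : Rd d} (hx : x ∈ M.complex.space) : ∑ k ∈ M.nodes, M.phi k x = 1 := by
  obtain ⟨T, hT, hxT⟩ := exists_mem_hull hx
  rw [← (isSimplex hT).sum_bary x]
  have hsub : T ⊆ M.nodes := fun k hk => mem_nodes_iff.2 ⟨T, hT, hk⟩
  rw [← Finset.sum_subset hsub]
  · exact Finset.sum_congr rfl fun k _ => phi_eq_bary hT hxT k
  · intro k _ hk
    simp [phi_eq_bary hT hxT, bary_of_notMem hk]

theorem phi_eventuallyEq {T : Finset (Rd d)} (hT : T ∈ M.simplices) {x : Rd d}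
    (hx : x ∈ interior (hull T)) (k : Rd d) : M.phi k =ᶠ[𝓝 x] bary T k := by
  filter_upwards [mem_interior_iff_mem_nhds.1 hx] with y hy
  exact phi_eq_bary hT hy k

theorem hasFDerivAt_phi {T : Finset (Rd d)} (hT : T ∈ M.simplices) {x : Rd d}
    (hx : x ∈ interior (hull T)) (k : Rd d) : HasFDerivAt (M.phi k) (baryGrad T k) x :=
  (hasFDerivAt_bary T k x).congr_of_eventuallyEq (phi_eventuallyEq hT hx k)

theorem inner_gradient_phi (x w : Rd d) (k : Rd d) :
    inner ℝ w (gradient (M.phi k) x) = fderiv ℝ (M.phi k) x w := by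
  rw [real_inner_comm, gradient, InnerProductSpace.toDual_symm_apply]

/-! ### Decomposition of the domain -/

/-- By cardinality `T` has a vertex that `T'` lacks; its coordinate vanishes on the overlap, which
therefore lies in a hyperplane. -/
theorem volume_hull_inter_hull {T T' : Finset (Rd d)} (hT : T ∈ M.simplices)
    (hT' : T' ∈ M.simplices) (hne : T ≠ T') : volume (hull T ∩ hull T') = 0 := by
  obtain ⟨k, hk, hk'⟩ : ∃ k ∈ T, k ∉ T' := by
    by_contra! h
    exact hne (Finset.eq_of_subset_of_card_le h (by rw [hT.2, hT'.2]))
  refine measure_mono_null (t := {x | bary T k x = 0}) ?_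
    (volume_affine_zero_set _ (p := k) (by simp [(isSimplex hT).bary_self hk]))
  rintro x ⟨hx, hx'⟩
  simp [bary_eq_bary hT hT' hx hx', bary_of_notMem hk']

theorem ae_mem_interior_of_mem_space :
    ∀ᵐ x, x ∈ M.complex.space → ∃ T ∈ M.simplices, x ∈ interior (hull T) := by
  have h : ∀ᵐ x, ∀ T ∈ M.elements, x ∉ frontier (hull T) :=
    (ae_ball_iff M.elements.countable_toSet).2 fun T _ =>
      measure_eq_zero_iff_ae_notMem.1 (volume_frontier_hull T)
  filter_upwards [h] with x hx hxs
  obtain ⟨T, hT, hxT⟩ := exists_mem_hull hxs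
  refine ⟨T, hT, ?_⟩
  by_contra hn
  exact hx T (mem_elements.2 hT) ⟨subset_closure hxT, hn⟩

theorem ae_mem_interior :
    ∀ᵐ x ∂volume.restrict M.domain, ∃ T ∈ M.simplices, x ∈ interior (hull T) := by
  rw [ae_restrict_iff' isOpen_domain.measurableSet]
  filter_upwards [ae_mem_interior_of_mem_space (M := M)] with x hx hxd
  exact hx (domain_subset_space hxd)

/-- The difference consists of points on simplex boundaries. Integrals over the open domain may thus
be taken over the union of the closed simplices. -/
theorem domain_ae_eq_space : M.domain =ᵐ[volume] M.complex.space := by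
  filter_upwards [ae_mem_interior_of_mem_space (M := M)] with x hx
  refine propext ⟨fun h => domain_subset_space h, fun h => ?_⟩
  obtain ⟨T, hT, hxT⟩ := hx h
  exact interior_hull_subset_domain hT hxT

theorem restrict_domain_eq_restrict_space :
    volume.restrict M.domain = volume.restrict M.complex.space :=
  Measure.restrict_congr_set domain_ae_eq_space

theorem aedisjoint_hull : (M.elements : Set (Finset (Rd d))).Pairwise
    (Function.onFun (AEDisjoint volume) hull) := fun _ hT _ hT' hne =>
  volume_hull_inter_hull (mem_elements.1 hT) (mem_elements.1 hT') hne

/-- Integrals over the domain are sums of integrals over the simplices. -/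
theorem integral_domain_eq_sum {f : Rd d → ℝ} (hf : IntegrableOn f M.domain) :
    ∫ x in M.domain, f x = ∑ T ∈ M.elements, ∫ x in hull T, f x := by
  rw [IntegrableOn, restrict_domain_eq_restrict_space] at hf
  rw [restrict_domain_eq_restrict_space, space_eq]
  exact integral_biUnion_finset_ae _ (fun T _ => (isClosed_hull T).measurableSet)
    aedisjoint_hull fun T hT => IntegrableOn.mono_set hf (hull_subset_space (mem_elements.1 hT))

theorem hull_subset_closure_interior {T : Finset (Rd d)} (hT : T ∈ M.simplices) :
    hull T ⊆ closure (interior (hull T)) := by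
  rw [(convex_hull T).closure_interior_eq_closure_of_nonempty_interior
    (isSimplex hT).interior_hull_nonempty]
  exact subset_closure

/-! ### Edges -/

theorem IsEdge.ne {i j : Rd d} (h : M.IsEdge i j) : i ≠ j := h.1

theorem IsEdge.symm {i j : Rd d} (h : M.IsEdge i j) : M.IsEdge j i :=
  ⟨h.1.symm, by simpa only [Finset.pair_comm] using h.2⟩

theorem isEdge_iff {i j : Rd d} : M.IsEdge i j ↔ i ≠ j ∧ ∃ T ∈ M.simplices, i ∈ T ∧ j ∈ T := by
  classical
  constructor
  · rintro ⟨hne, h⟩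
    obtain ⟨T, hT, hs, hc⟩ := M.pure _ h
    exact ⟨hne, T, ⟨hT, hc⟩, hs (by simp), hs (by simp)⟩
  · rintro ⟨hne, T, hT, hi, hj⟩
    refine ⟨hne, M.complex.down_closed hT.1 ?_ (by simp)⟩
    intro k hk
    rcases Finset.mem_insert.1 hk with rfl | hk
    · exact hi
    · rwa [Finset.mem_singleton.1 hk]

theorem IsEdge.left_mem {i j : Rd d} (h : M.IsEdge i j) : i ∈ M.nodes := by
  obtain ⟨-, T, hT, hi, -⟩ := isEdge_iff.1 h
  exact mem_nodes_iff.2 ⟨T, hT, hi⟩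

theorem IsEdge.right_mem {i j : Rd d} (h : M.IsEdge i j) : j ∈ M.nodes := h.symm.left_mem

theorem IsBoundaryEdge.symm {i j : Rd d} (h : M.IsBoundaryEdge i j) : M.IsBoundaryEdge j i :=
  ⟨h.1.symm, by rw [segment_symm]; exact h.2⟩

theorem IsInteriorEdge.symm {i j : Rd d} (h : M.IsInteriorEdge i j) : M.IsInteriorEdge j i :=
  ⟨h.1.symm, by rw [segment_symm]; exact h.2⟩

theorem IsBoundaryEdge.left_notMem {i j : Rd d} (h : M.IsBoundaryEdge i j) : i ∉ M.domain :=
  fun hi => by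
    have := h.2 (left_mem_segment ℝ i j)
    rw [isOpen_domain.frontier_eq] at this
    exact this.2 hi

theorem isInteriorEdge_of_mem_domain {i m : Rd d} (h : M.IsEdge i m) (hm : m ∈ M.domain) :
    M.IsInteriorEdge i m :=
  ⟨h, fun hs => by
    have := hs (right_mem_segment ℝ i m)
    rw [isOpen_domain.frontier_eq] at this
    exact this.2 hm⟩

theorem exists_isChoice (hM : M.HasInteriorNodes) : ∃ m, M.IsChoice m := by
  classical
  -- Choosing for the unordered pair makes the choice symmetric. Any interior node of a simplex
  -- through the edge works: the ends of a boundary edge are not in the open domain, so it differs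
  -- from both. The value 0 is used only for sets in no simplex.
  have h : ∀ e : Finset (Rd d), ∃ m : Rd d, ∀ i j, e = {i, j} → M.IsBoundaryEdge i j →
      m ∈ M.nodes ∧ m ∈ M.domain ∧ M.IsInteriorEdge i m ∧ M.IsInteriorEdge j m := by
    intro e
    by_cases he : ∃ T ∈ M.simplices, e ⊆ T
    · obtain ⟨T, hT, heT⟩ := he
      obtain ⟨m, hmT, hm⟩ := hM T hT
      refine ⟨m, ?_⟩
      rintro i j rfl hb
      have hi : i ∈ T := heT (by simp)
      have hj : j ∈ T := heT (by simp)
      refine ⟨mem_nodes_iff.2 ⟨T, hT, hmT⟩, hm, ?_, ?_⟩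
      · refine isInteriorEdge_of_mem_domain (isEdge_iff.2 ⟨?_, T, hT, hi, hmT⟩) hm
        rintro rfl
        exact hb.left_notMem hm
      · refine isInteriorEdge_of_mem_domain (isEdge_iff.2 ⟨?_, T, hT, hj, hmT⟩) hm
        rintro rfl
        exact hb.symm.left_notMem hm
    · refine ⟨0, ?_⟩
      rintro i j rfl hb
      obtain ⟨-, T, hT, hi, hj⟩ := isEdge_iff.1 hb.1
      exact absurd ⟨T, hT, by simp [Finset.insert_subset_iff, hi, hj]⟩ he
  choose f hf using h
  refine ⟨fun i j => f {i, j}, fun i j hb => ⟨?_, hf _ i j rfl hb⟩⟩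
  simp only [Finset.pair_comm]

theorem psi_mem_edgeSpace {m : Rd d → Rd d → Rd d} (hm : M.IsChoice m) {i j : Rd d}
    (h : M.IsEdge i j) : M.psi m i j ∈ M.edgeSpace := by
  have hb : ∀ k l, M.IsInteriorEdge k l → M.b k l ∈ M.edgeSpace := fun k l hkl =>
    Submodule.smul_mem _ _ (Submodule.subset_span ⟨k, l, hkl, rfl⟩)
  rw [psi]
  split_ifs with hbd
  · obtain ⟨-, -, -, h1, h2⟩ := hm i j hbd
    exact Submodule.add_mem _ (hb _ _ h1) (hb _ _ h2.symm)
  · exact hb i j ⟨h, fun hs => hbd ⟨h, hs⟩⟩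

theorem pi2_mem_edgeSpace {m : Rd d → Rd d → Rd d} (hm : M.IsChoice m) (v : Rd d → Rd d) :
    M.Pi2 m v ∈ M.edgeSpace := by
  classical
  refine Submodule.sum_mem _ fun i _ => Submodule.neg_mem _ (Submodule.sum_mem _ fun j hj => ?_)
  exact Submodule.smul_mem _ _ (psi_mem_edgeSpace hm (Finset.mem_filter.1 hj).2.symm)

end Mesh

end Fortin

namespace Fortin

variable {d : ℕ}

/-! ### Weak derivatives of locally Lipschitz functions -/

/-- `f` is bounded on `Ω`, Lipschitz along all segments in `Ω`, and differentiable almost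
everywhere in `Ω`. -/
structure SegLip (Ω : Set (Rd d)) (f : Rd d → ℝ) : Prop where
  lip : ∃ K : ℝ, 0 ≤ K ∧ ∀ x y, segment ℝ x y ⊆ Ω → |f x - f y| ≤ K * ‖x - y‖
  bdd : ∃ B : ℝ, ∀ x ∈ Ω, |f x| ≤ B
  diff : ∀ᵐ x ∂volume.restrict Ω, DifferentiableAt ℝ f x

namespace SegLip

variable {Ω : Set (Rd d)} {f g : Rd d → ℝ}

theorem mul (hf : SegLip Ω f) (hg : SegLip Ω g) : SegLip Ω (fun x => f x * g x) := by
  obtain ⟨K, hK, hfK⟩ := hf.lip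
  obtain ⟨L, hL, hgL⟩ := hg.lip
  obtain ⟨B, hB⟩ := hf.bdd
  obtain ⟨D, hD⟩ := hg.bdd
  refine ⟨⟨|B| * L + K * |D|, by positivity, fun x y hxy => ?_⟩, ⟨|B| * |D|, fun x hx => ?_⟩, ?_⟩
  · have hx := hxy (left_mem_segment ℝ x y)
    have hy := hxy (right_mem_segment ℝ x y)
    have e : f x * g x - f y * g y = f x * (g x - g y) + (f x - f y) * g y := by ring
    calc |f x * g x - f y * g y| ≤ |f x| * |g x - g y| + |f x - f y| * |g y| := by
          rw [e, ← abs_mul, ← abs_mul]; exact abs_add_le _ _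
      _ ≤ |B| * (L * ‖x - y‖) + K * ‖x - y‖ * |D| := by
          have h1 := (hB x hx).trans (le_abs_self B)
          have h2 := (hD y hy).trans (le_abs_self D)
          have h3 := hfK x y hxy
          have h4 := hgL x y hxy
          gcongr
      _ = _ := by ring
  · rw [abs_mul]
    have h1 := (hB x hx).trans (le_abs_self B)
    have h2 := (hD x hx).trans (le_abs_self D)
    gcongr
  · filter_upwards [hf.diff, hg.diff] with x h1 h2
    exact h1.mul h2

theorem exists_ball_lip (hΩ : IsOpen Ω) {K : ℝ}
    (hK : ∀ x y, segment ℝ x y ⊆ Ω → |f x - f y| ≤ K * ‖x - y‖) {x : Rd d} (hx : x ∈ Ω) :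
    ∀ᶠ y in 𝓝 x, |f y - f x| ≤ K * ‖y - x‖ := by
  obtain ⟨ε, hε, hb⟩ := Metric.isOpen_iff.1 hΩ x hx
  filter_upwards [Metric.ball_mem_nhds x hε] with y hy
  exact hK y x (((convex_ball x ε).segment_subset hy (Metric.mem_ball_self hε)).trans hb)

theorem continuousOn (hf : SegLip Ω f) (hΩ : IsOpen Ω) : ContinuousOn f Ω := by
  intro x hx
  obtain ⟨K, hK, hfK⟩ := hf.lip
  refine ContinuousAt.continuousWithinAt ?_
  rw [ContinuousAt, tendsto_iff_norm_sub_tendsto_zero]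
  refine squeeze_zero' (Eventually.of_forall fun _ => norm_nonneg _)
    (g := fun y => K * ‖y - x‖) (exists_ball_lip hΩ hfK hx) ?_
  have : Continuous fun y : Rd d => K * ‖y - x‖ := by fun_prop
  simpa using this.tendsto x

theorem exists_norm_fderiv_le (hf : SegLip Ω f) (hΩ : IsOpen Ω) :
    ∃ K : ℝ, 0 ≤ K ∧ ∀ x ∈ Ω, ‖fderiv ℝ f x‖ ≤ K := by
  obtain ⟨K, hK, hfK⟩ := hf.lip
  exact ⟨K, hK, fun x hx => norm_fderiv_le_of_lip' ℝ hK (exists_ball_lip hΩ hfK hx)⟩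

theorem aestronglyMeasurable (hf : SegLip Ω f) (hΩ : IsOpen Ω) :
    AEStronglyMeasurable f (volume.restrict Ω) :=
  (hf.continuousOn hΩ).aestronglyMeasurable hΩ.measurableSet

/-- Multiplication by a bounded measurable function preserves integrability. -/
theorem integrable_mul (hf : SegLip Ω f) (hΩ : IsOpen Ω) {u : Rd d → ℝ} (hu : IntegrableOn u Ω) :
    IntegrableOn (fun x => f x * u x) Ω := by
  obtain ⟨B, hB⟩ := hf.bdd
  exact Integrable.bdd_mul hu (hf.aestronglyMeasurable hΩ)
    ((ae_restrict_iff' hΩ.measurableSet).2 (ae_of_all _ hB))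

theorem integrable_fderiv_apply (hf : SegLip Ω f) (hΩ : IsOpen Ω) {v : Rd d → Rd d}
    (hv : IntegrableOn v Ω) : IntegrableOn (fun x => fderiv ℝ f x (v x)) Ω := by
  obtain ⟨K, hK, hfK⟩ := hf.exists_norm_fderiv_le hΩ
  refine Integrable.mono' (hv.norm.const_mul K) ?_ ?_
  · exact (ContinuousLinearMap.apply ℝ ℝ : Rd d →L[ℝ] _).flip.aestronglyMeasurable_comp₂
      (measurable_fderiv ℝ f).aestronglyMeasurable hv.1
  · refine (ae_restrict_iff' hΩ.measurableSet).2 (ae_of_all _ fun x hx => ?_)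
    exact ((fderiv ℝ f x).le_opNorm _).trans (by gcongr; exact hfK x hx)

theorem integrable_fderiv (hf : SegLip Ω f) (hΩ : IsOpen Ω)
    [IsFiniteMeasure (volume.restrict Ω)] : IntegrableOn (fderiv ℝ f) Ω := by
  obtain ⟨K, hK, hfK⟩ := hf.exists_norm_fderiv_le hΩ
  exact Integrable.of_bound (measurable_fderiv ℝ f).aestronglyMeasurable K
    ((ae_restrict_iff' hΩ.measurableSet).2 (ae_of_all _ hfK))

theorem integrableOn (hf : SegLip Ω f) (hΩ : IsOpen Ω)
    [IsFiniteMeasure (volume.restrict Ω)] : IntegrableOn f Ω := by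
  obtain ⟨B, hB⟩ := hf.bdd
  exact Integrable.of_bound (hf.aestronglyMeasurable hΩ) B
    ((ae_restrict_iff' hΩ.measurableSet).2 (ae_of_all _ hB))

/-- Nothing is known about `f` outside `Ω`, but the product with a test function is Lipschitz on the
whole space. Within distance `δ` of a point of the support, segments stay in `Ω` and the product
rule applies; at larger distances the bound on the product, divided by `δ`, suffices. -/
theorem lipschitz_test_mul (hf : SegLip Ω f) (hΩ : IsOpen Ω) {η : Rd d → ℝ}
    (hη : IsTestFunction Ω η) : ∃ L, LipschitzWith L (fun x => η x * f x) := by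
  obtain ⟨hsm, hcs, hsup⟩ := hη
  obtain ⟨K, hK, hfK⟩ := hf.lip
  obtain ⟨B, hB⟩ := hf.bdd
  obtain ⟨E, hE⟩ := hcs.exists_bound_of_continuous hsm.continuous
  obtain ⟨L, hL⟩ := hsm.lipschitzWith_of_hasCompactSupport hcs (by simp)
  obtain ⟨δ, hδ, hth⟩ := hcs.isCompact.exists_thickening_subset_open hΩ hsup
  have hFb : ∀ x, |η x * f x| ≤ E * |B| := by
    intro x
    have hE0 : 0 ≤ E := (norm_nonneg _).trans (hE x)
    by_cases hx : x ∈ tsupport η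
    · rw [abs_mul]
      have h1 := (hB x (hsup hx)).trans (le_abs_self B)
      have h2 : |η x| ≤ E := hE x
      gcongr
    · rw [image_eq_zero_of_notMem_tsupport hx, zero_mul, abs_zero]
      positivity
  have hE0 : 0 ≤ E := (norm_nonneg _).trans (hE 0)
  set C : ℝ := E * K + L * |B| + 2 * (E * |B|) / δ with hC
  have key : ∀ x y, x ∈ tsupport η → |η x * f x - η y * f y| ≤ C * ‖x - y‖ := by
    intro x y hx
    rcases lt_or_ge ‖x - y‖ δ with h | h
    · have hball : Metric.ball x δ ⊆ Ω := (Metric.ball_subset_thickening hx δ).trans hth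
      have hy : y ∈ Metric.ball x δ := by rwa [Metric.mem_ball', dist_eq_norm]
      have hseg := ((convex_ball x δ).segment_subset (Metric.mem_ball_self hδ) hy).trans hball
      have h1 := hfK x y hseg
      have h2 : |η x| ≤ E := hE x
      have h3 := (hB y (hball hy)).trans (le_abs_self B)
      have h4 : |η x - η y| ≤ L * ‖x - y‖ := by
        have := hL.dist_le_mul x y
        rwa [dist_eq_norm, dist_eq_norm] at this
      have e : η x * f x - η y * f y = η x * (f x - f y) + (η x - η y) * f y := by ring
      calc |η x * f x - η y * f y| ≤ |η x| * |f x - f y| + |η x - η y| * |f y| := by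
            rw [e, ← abs_mul, ← abs_mul]; exact abs_add_le _ _
        _ ≤ E * (K * ‖x - y‖) + L * ‖x - y‖ * |B| := by gcongr
        _ = (E * K + L * |B|) * ‖x - y‖ := by ring
        _ ≤ C * ‖x - y‖ := by
            gcongr
            exact le_add_of_nonneg_right (by positivity)
    · calc |η x * f x - η y * f y| ≤ E * |B| + E * |B| :=
            (abs_sub _ _).trans (add_le_add (hFb x) (hFb y))
        _ = 2 * (E * |B|) / δ * δ := by field_simp; ring
        _ ≤ 2 * (E * |B|) / δ * ‖x - y‖ := by gcongr
        _ ≤ C * ‖x - y‖ := by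
            gcongr
            exact le_add_of_nonneg_left (by positivity)
  refine ⟨_, LipschitzWith.of_dist_le' (K := C) fun x y => ?_⟩
  rw [Real.dist_eq, dist_eq_norm]
  by_cases hx : x ∈ tsupport η
  · exact key x y hx
  · by_cases hy : y ∈ tsupport η
    · rw [abs_sub_comm, norm_sub_rev]
      exact key y x hy
    · rw [image_eq_zero_of_notMem_tsupport hx, image_eq_zero_of_notMem_tsupport hy]
      simp only [zero_mul, sub_self, abs_zero]
      positivity

/-- The classical derivative is a weak derivative. -/
theorem integral_fderiv_mul (hf : SegLip Ω f) (hΩ : IsOpen Ω)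
    [IsFiniteMeasure (volume.restrict Ω)] {η : Rd d → ℝ} (hη : IsTestFunction Ω η) (e : Rd d) :
    ∫ x in Ω, fderiv ℝ η x e * f x = - ∫ x in Ω, η x * fderiv ℝ f x e := by
  obtain ⟨L, hL⟩ := hf.lipschitz_test_mul hΩ hη
  obtain ⟨hsm, hcs, hsup⟩ := hη
  set F : Rd d → ℝ := fun x => η x * f x with hF
  have hFcs : HasCompactSupport F := hcs.mul_right
  have h0 : ∫ x, lineDeriv ℝ F x e = 0 := by
    -- Integration by parts against the constant 1; the direction is `-e` because the formula
    -- reverses it on the other factor.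
    have := (LipschitzWith.const (1 : ℝ)).integral_lineDeriv_mul_eq (μ := volume)
      hL hFcs (-e)
    simpa [lineDeriv] using this.symm
  have hout : ∀ x, x ∉ Ω → lineDeriv ℝ F x e = 0 := by
    intro x hx
    have h1 : F =ᶠ[𝓝 x] 0 := by
      rw [← notMem_tsupport_iff_eventuallyEq]
      exact fun h => hx (hsup (closure_mono (Function.support_mul_subset_left η f) h))
    rw [h1.lineDeriv_eq]
    simp [lineDeriv]
  rw [← setIntegral_eq_integral_of_forall_compl_eq_zero hout] at h0
  have hηd : Differentiable ℝ η := hsm.differentiable (by simp)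
  have hae : ∀ᵐ x ∂volume.restrict Ω, lineDeriv ℝ F x e =
      fderiv ℝ η x e * f x + η x * fderiv ℝ f x e := by
    filter_upwards [hf.diff] with x hx
    have hd : HasFDerivAt F _ x := (hηd x).hasFDerivAt.mul hx.hasFDerivAt
    rw [hd.differentiableAt.lineDeriv_eq_fderiv, hd.fderiv]
    simp [mul_comm, add_comm]
  rw [integral_congr_ae hae, integral_add] at h0
  · linarith
  · have hc : Continuous fun x => fderiv ℝ η x e :=
      (hsm.continuous_fderiv (by simp)).clm_apply continuous_const
    have := hf.integrable_mul hΩ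
      (hc.integrable_of_hasCompactSupport (hcs.fderiv_apply ℝ e)).integrableOn
    simpa only [mul_comm, IntegrableOn] using this
  · obtain ⟨E, hE⟩ := hcs.exists_bound_of_continuous hsm.continuous
    exact Integrable.bdd_mul (hf.integrable_fderiv_apply hΩ (integrable_const e))
      hsm.continuous.aestronglyMeasurable (ae_of_all _ hE)

end SegLip

namespace Mesh

variable {M : Mesh d}

/-- On each simplex `phi` is affine, with gradient bounded by the sum of all the local gradient
norms. A segment may cross simplices in a complicated way, so the bound is propagated along it by
continuous induction on the closed set `S` of parameters where it holds. -/
theorem segLip_phi (M : Mesh d) (k : Rd d) : SegLip M.domain (M.phi k) := by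
  refine ⟨⟨∑ T ∈ M.elements, ‖baryGrad T k‖, by positivity, fun x y hxy => ?_⟩,
    ⟨1, fun x hx => abs_phi_le_one (domain_subset_space hx) k⟩, ?_⟩
  · set K := ∑ T ∈ M.elements, ‖baryGrad T k‖ with hK
    set γ : ℝ → Rd d := fun t => x + t • (y - x) with hγ
    have hγc : Continuous γ := by fun_prop
    have hγs : ∀ t ∈ Icc (0 : ℝ) 1, γ t ∈ M.complex.space := fun t ht =>
      domain_subset_space (hxy (by rw [segment_eq_image']; exact ⟨t, ht, rfl⟩))
    set S : Set ℝ := ⋃ T ∈ M.elements,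
      {t | γ t ∈ hull T ∧ |bary T k (γ t) - M.phi k x| ≤ K * (t * ‖y - x‖)} with hS
    have hSc : IsClosed S := by
      refine M.elements.finite_toSet.isClosed_biUnion fun T _ => ?_
      have h1 := (continuous_bary T k).comp hγc
      exact ((isClosed_hull T).preimage hγc).inter (isClosed_le
        (f := fun t => |bary T k (γ t) - M.phi k x|) (g := fun t => K * (t * ‖y - x‖))
        (h1.sub continuous_const).abs (by fun_prop))
    have hS0 : (0 : ℝ) ∈ S := by
      obtain ⟨T, hT, hxT⟩ := exists_mem_hull (hγs 0 (by simp))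
      refine mem_biUnion (mem_elements.2 hT) ⟨hxT, ?_⟩
      have h0 : γ 0 = x := by simp [hγ]
      rw [h0] at hxT ⊢
      rw [phi_eq_bary hT hxT]
      simp
    have hsub : Icc (0 : ℝ) 1 ⊆ S := by
      refine (hSc.inter isClosed_Icc).Icc_subset_of_forall_exists_gt hS0 ?_
      rintro t ⟨htS, ht⟩ u hu
      -- As there are finitely many simplices, one of them is visited at times arbitrarily close to
      -- the right of `t`. Being closed it also contains the point at time `t`, and `phi` is affine
      -- between the two points.
      have hfreq : ∃ T ∈ M.elements, ∃ᶠ z in 𝓝[>] t, γ z ∈ hull T := by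
        by_contra! h
        have h1 : ∀ᶠ z in 𝓝[>] t, ∀ T ∈ M.elements, γ z ∉ hull T :=
          (Filter.eventually_all_finset _).2 fun T hT => by
            simpa [Filter.not_frequently] using h T hT
        have h2 : ∀ᶠ z in 𝓝[>] t, z ∈ Ioc t 1 := Ioc_mem_nhdsGT ht.2
        obtain ⟨z, hz1, hz2⟩ := (h1.and h2).exists
        obtain ⟨T, hT, hzT⟩ := exists_mem_hull (hγs z ⟨ht.1.trans hz2.1.le, hz2.2⟩)
        exact hz1 T (mem_elements.2 hT) hzT
      obtain ⟨T, hT, hfr⟩ := hfreq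
      have hT' := mem_elements.1 hT
      have htT : γ t ∈ hull T := by
        have hcl : IsClosed (γ ⁻¹' hull T) := (isClosed_hull T).preimage hγc
        exact hcl.closure_subset (mem_closure_iff_frequently.2 (hfr.filter_mono
          nhdsWithin_le_nhds))
      obtain ⟨z, hz, hzu⟩ := (hfr.and_eventually (Ioc_mem_nhdsGT hu)).exists
      refine ⟨z, mem_biUnion hT ⟨hz, ?_⟩, hzu⟩
      obtain ⟨T₀, hT₀, htT₀, hle⟩ := mem_iUnion₂.1 htS
      rw [bary_eq_bary (mem_elements.1 hT₀) hT' htT₀ htT] at hle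
      have hdiff : bary T k (γ z) - bary T k (γ t) = (z - t) * baryGrad T k (y - x) := by
        rw [bary_sub_bary]
        have : γ z - γ t = (z - t) • (y - x) := by simp only [hγ, sub_smul]; abel
        rw [this, map_smul, smul_eq_mul]
      have hbd : |baryGrad T k (y - x)| ≤ K * ‖y - x‖ :=
        ((baryGrad T k).le_opNorm _).trans (by
          gcongr
          exact Finset.single_le_sum (f := fun T => ‖baryGrad T k‖)
            (fun _ _ => norm_nonneg _) hT)
      have hzt : 0 ≤ z - t := sub_nonneg.2 hzu.1.le
      calc |bary T k (γ z) - M.phi k x|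
          ≤ |bary T k (γ z) - bary T k (γ t)| + |bary T k (γ t) - M.phi k x| :=
            abs_sub_le _ _ _
        _ ≤ (z - t) * (K * ‖y - x‖) + K * (t * ‖y - x‖) := by
            refine add_le_add ?_ hle
            rw [hdiff, abs_mul, abs_of_nonneg hzt]
            gcongr
        _ = K * (z * ‖y - x‖) := by ring
    obtain ⟨T, hT, hyT, hle⟩ := mem_iUnion₂.1 (hsub (right_mem_Icc.2 zero_le_one))
    have h1 : γ 1 = y := by simp [hγ]
    rw [h1] at hyT hle
    rw [← phi_eq_bary (mem_elements.1 hT) hyT, one_mul] at hle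
    rwa [abs_sub_comm, norm_sub_rev]
  · filter_upwards [ae_mem_interior (M := M)] with x hx
    obtain ⟨T, hT, hxT⟩ := hx
    exact (hasFDerivAt_phi hT hxT k).differentiableAt

end Mesh

end Fortin

/-! ### Divergence and integration by parts in Sobolev spaces -/

namespace Fortin

variable {d : ℕ}

/-- The trace as a continuous linear functional. -/
def traceCLM (d : ℕ) : (Rd d →L[ℝ] Rd d) →L[ℝ] ℝ :=
  ∑ a : Fin d, (EuclideanSpace.proj a : Rd d →L[ℝ] ℝ).comp
    (ContinuousLinearMap.apply ℝ (Rd d) (EuclideanSpace.single a (1 : ℝ)))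

theorem divOf_eq_trace (G : Rd d → Rd d →L[ℝ] Rd d) (x : Rd d) :
    divOf G x = traceCLM d (G x) := by
  simp [divOf, traceCLM]

theorem clm_eq_sum_single (L : Rd d →L[ℝ] ℝ) (w : Rd d) :
    L w = ∑ a : Fin d, w a * L (EuclideanSpace.single a 1) := by
  have h : w = ∑ a : Fin d, w a • EuclideanSpace.single a (1 : ℝ) := by
    ext b
    simp [Finset.sum_apply, Pi.single_apply]
  conv_lhs => rw [h, map_sum]
  simp

/-- In this form the divergence of `f • w`, with `w` constant, is the derivative of `f` along `w`.
-/
theorem traceCLM_smulRight (L : Rd d →L[ℝ] ℝ) (w : Rd d) : traceCLM d (L.smulRight w) = L w := by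
  rw [clm_eq_sum_single L w]
  simp [traceCLM, mul_comm]

theorem memW11_smul_const {Ω : Set (Rd d)} (hΩ : IsOpen Ω) [IsFiniteMeasure (volume.restrict Ω)]
    {f : Rd d → ℝ} (hf : SegLip Ω f) (w : Rd d) :
    MemW11 Ω (fun x => f x • w) (fun x => (fderiv ℝ f x).smulRight w) where
  integrable := (hf.integrableOn hΩ).smul_const w
  integrable_grad :=
    ((ContinuousLinearMap.smulRightL ℝ (Rd d) (Rd d)).flip w).integrable_comp
      (hf.integrable_fderiv hΩ)
  weak η hη e := by
    simp only [ContinuousLinearMap.smulRight_apply, smul_smul]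
    rw [integral_smul_const, integral_smul_const, hf.integral_fderiv_mul hΩ hη e, neg_smul]

/-- Test fields are integrable. -/
theorem IsTestFunction.integrable {Ω : Set (Rd d)} {u : Rd d → Rd d} (hu : IsTestFunction Ω u) :
    Integrable u :=
  hu.1.continuous.integrable_of_hasCompactSupport hu.2.1

theorem IsTestFunction.integrable_fderiv {Ω : Set (Rd d)} {u : Rd d → Rd d}
    (hu : IsTestFunction Ω u) : Integrable (fderiv ℝ u) :=
  (hu.1.continuous_fderiv (by simp)).integrable_of_hasCompactSupport (hu.2.1.fderiv ℝ)

theorem IsTestFunction.component {Ω : Set (Rd d)} {u : Rd d → Rd d}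
    (hu : IsTestFunction Ω u) (a : Fin d) : IsTestFunction Ω (fun x => u x a) := by
  have hsub : tsupport (fun x => u x a) ⊆ tsupport u := by
    refine closure_mono fun x hx => ?_
    rw [Function.mem_support] at hx ⊢
    intro h
    simp [h] at hx
  refine ⟨(EuclideanSpace.proj a : Rd d →L[ℝ] ℝ).contDiff.comp hu.1, ?_, hsub.trans hu.2.2⟩
  exact hu.2.1.of_isClosed_subset (isClosed_tsupport _) hsub

/-- Integration by parts against a test field. -/
theorem SegLip.integral_div_test {Ω : Set (Rd d)} {f : Rd d → ℝ} (hf : SegLip Ω f)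
    (hΩ : IsOpen Ω) [IsFiniteMeasure (volume.restrict Ω)] {u : Rd d → Rd d}
    (hu : IsTestFunction Ω u) :
    ∫ x in Ω, divOf (fderiv ℝ u) x * f x = - ∫ x in Ω, fderiv ℝ f x (u x) := by
  have hud : Differentiable ℝ u := hu.1.differentiable (by simp)
  have hcomp : ∀ (a : Fin d) (x e : Rd d), fderiv ℝ (fun y => u y a) x e = fderiv ℝ u x e a := by
    intro a x e
    have : HasFDerivAt (fun y => u y a)
        ((EuclideanSpace.proj a : Rd d →L[ℝ] ℝ).comp (fderiv ℝ u x)) x :=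
      (EuclideanSpace.proj a : Rd d →L[ℝ] ℝ).hasFDerivAt.comp x (hud x).hasFDerivAt
    rw [this.fderiv]
    rfl
  have h1 : ∀ x, divOf (fderiv ℝ u) x * f x =
      ∑ a : Fin d, fderiv ℝ (fun y => u y a) x (EuclideanSpace.single a 1) * f x := by
    intro x
    rw [divOf, Finset.sum_mul]
    exact Finset.sum_congr rfl fun a _ => by rw [hcomp]
  have h2 : ∀ x, fderiv ℝ f x (u x) =
      ∑ a : Fin d, u x a * fderiv ℝ f x (EuclideanSpace.single a 1) := fun x =>
    clm_eq_sum_single _ _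
  simp only [h1, h2]
  rw [integral_finsetSum, integral_finsetSum, ← Finset.sum_neg_distrib]
  · exact Finset.sum_congr rfl fun a _ => hf.integral_fderiv_mul hΩ (hu.component a) _
  · intro a _
    obtain ⟨E, hE⟩ := (hu.component a).2.1.exists_bound_of_continuous
      (hu.component a).1.continuous
    exact Integrable.bdd_mul (hf.integrable_fderiv_apply hΩ (integrable_const _))
      (hu.component a).1.continuous.aestronglyMeasurable (ae_of_all _ hE)
  · intro a _
    have hc : Continuous fun x => fderiv ℝ (fun y => u y a) x (EuclideanSpace.single a 1) :=
      ((hu.component a).1.continuous_fderiv (by simp)).clm_apply continuous_const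
    have := hf.integrable_mul hΩ (hc.integrable_of_hasCompactSupport
      ((hu.component a).2.1.fderiv_apply ℝ _)).integrableOn
    simpa only [mul_comm, IntegrableOn] using this

theorem SegLip.integrable_trace_mul {Ω : Set (Rd d)} {f : Rd d → ℝ} (hf : SegLip Ω f)
    (hΩ : IsOpen Ω) {G : Rd d → Rd d →L[ℝ] Rd d} (hG : IntegrableOn G Ω) :
    IntegrableOn (fun x => divOf G x * f x) Ω := by
  have := hf.integrable_mul hΩ ((traceCLM d).integrable_comp hG)
  simpa only [mul_comm, IntegrableOn, divOf_eq_trace] using this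

/-- If `F uₙ` differs from `F v` by at most `C ‖uₙ - v‖` and `uₙ → v` in `L¹` then the integrals
converge. -/
theorem tendsto_integral_of_L1 {X E : Type*} [MeasurableSpace X] {μ : Measure X}
    [NormedAddCommGroup E] {u : ℕ → X → E} {v : X → E} (hu : ∀ n, Integrable (u n) μ)
    (hv : Integrable v μ) (h : Tendsto (fun n => ∫ x, ‖u n x - v x‖ ∂μ) atTop (𝓝 0))
    {F : X → E → ℝ} {C : ℝ} (hFu : ∀ n, Integrable (fun x => F x (u n x)) μ)
    (hFv : Integrable (fun x => F x (v x)) μ)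
    (hF : ∀ᵐ x ∂μ, ∀ a b, |F x a - F x b| ≤ C * ‖a - b‖) :
    Tendsto (fun n => ∫ x, F x (u n x) ∂μ) atTop (𝓝 (∫ x, F x (v x) ∂μ)) := by
  rw [tendsto_iff_norm_sub_tendsto_zero]
  refine squeeze_zero (fun _ => norm_nonneg _) (fun n => ?_) (by simpa using h.const_mul C)
  rw [← integral_sub (hFu n) hFv, ← integral_const_mul]
  refine norm_integral_le_of_norm_le ((((hu n).sub hv).norm).const_mul C) ?_
  filter_upwards [hF] with x hx
  exact hx _ _

/-- Integration by parts for fields in `W^{1,1}_0`. -/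
theorem SegLip.integral_div {Ω : Set (Rd d)} {f : Rd d → ℝ} (hf : SegLip Ω f)
    (hΩ : IsOpen Ω) [IsFiniteMeasure (volume.restrict Ω)] {v : Rd d → Rd d}
    {G : Rd d → Rd d →L[ℝ] Rd d} (hv : MemW110 Ω v G) :
    ∫ x in Ω, divOf G x * f x = - ∫ x in Ω, fderiv ℝ f x (v x) := by
  obtain ⟨u, hu, h1, h2⟩ := hv.approx
  obtain ⟨K, hK, hfK⟩ := hf.exists_norm_fderiv_le hΩ
  obtain ⟨B, hB⟩ := hf.bdd
  have t1 : Tendsto (fun n => ∫ x in Ω, fderiv ℝ f x (u n x)) atTop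
      (𝓝 (∫ x in Ω, fderiv ℝ f x (v x))) := by
    refine tendsto_integral_of_L1 (F := fun x w => fderiv ℝ f x w) (C := K)
      (fun n => (hu n).integrable.integrableOn) hv.integrable h1
      (fun n => hf.integrable_fderiv_apply hΩ (hu n).integrable.integrableOn)
      (hf.integrable_fderiv_apply hΩ hv.integrable) ?_
    refine (ae_restrict_iff' hΩ.measurableSet).2 (ae_of_all _ fun x hx a b => ?_)
    rw [← map_sub]
    exact ((fderiv ℝ f x).le_opNorm _).trans (by gcongr; exact hfK x hx)
  have t2 : Tendsto (fun n => ∫ x in Ω, divOf (fderiv ℝ (u n)) x * f x) atTop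
      (𝓝 (∫ x in Ω, divOf G x * f x)) := by
    simp only [divOf_eq_trace]
    refine tendsto_integral_of_L1 (F := fun x A => traceCLM d A * f x) (C := ‖traceCLM d‖ * |B|)
      (fun n => (hu n).integrable_fderiv.integrableOn) hv.integrable_grad h2
      (fun n => ?_) ?_ ?_
    · simpa only [divOf_eq_trace, IntegrableOn] using
        hf.integrable_trace_mul hΩ (hu n).integrable_fderiv.integrableOn
    · simpa only [divOf_eq_trace, IntegrableOn] using hf.integrable_trace_mul hΩ hv.integrable_grad
    · refine (ae_restrict_iff' hΩ.measurableSet).2 (ae_of_all _ fun x hx a b => ?_)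
      rw [← sub_mul, ← map_sub, abs_mul]
      have e1 : |traceCLM d (a - b)| ≤ ‖traceCLM d‖ * ‖a - b‖ := (traceCLM d).le_opNorm _
      have e2 := (hB x hx).trans (le_abs_self B)
      calc |traceCLM d (a - b)| * |f x| ≤ ‖traceCLM d‖ * ‖a - b‖ * |B| := by gcongr
        _ = _ := by ring
  -- The identity is known for the approximating test fields, and both sides are continuous for the
  -- convergence in `W^{1,1}`.
  refine tendsto_nhds_unique t2 ?_
  simp only [fun n => hf.integral_div_test hΩ (hu n)]
  exact t1.neg

/-- `Integrable.add`, with instances that unify for spaces of continuous linear maps. -/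
theorem integrable_add_of_normed {X E : Type*} [MeasurableSpace X] {μ : Measure X}
    [NormedAddCommGroup E] {f g : X → E} (hf : Integrable f μ) (hg : Integrable g μ) :
    Integrable (f + g) μ :=
  hf.add hg

/-- `integrable_zero`, with instances that unify for spaces of continuous linear maps. -/
theorem integrable_zero_of_normed {X E : Type*} [MeasurableSpace X] {μ : Measure X}
    [NormedAddCommGroup E] : Integrable (0 : X → E) μ :=
  integrable_zero _ _ _

theorem MemW11.add {Ω : Set (Rd d)} {u u' : Rd d → Rd d} {H H' : Rd d → Rd d →L[ℝ] Rd d}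
    (hH : MemW11 Ω u H) (hH' : MemW11 Ω u' H') : MemW11 Ω (u + u') (H + H') := by
  refine ⟨Integrable.add hH.integrable hH'.integrable,
    integrable_add_of_normed hH.integrable_grad hH'.integrable_grad, fun η hη e => ?_⟩
  have hc : Continuous fun x => fderiv ℝ η x e :=
    (hη.1.continuous_fderiv (by simp)).clm_apply continuous_const
  obtain ⟨B, hB⟩ := (hη.2.1.fderiv_apply ℝ e).exists_bound_of_continuous hc
  obtain ⟨E, hE⟩ := hη.2.1.exists_bound_of_continuous hη.1.continuous
  have i1 : ∀ w : Rd d → Rd d, IntegrableOn w Ω →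
      IntegrableOn (fun x => fderiv ℝ η x e • w x) Ω := fun w hw =>
    Integrable.bdd_smul hw B hc.aestronglyMeasurable (ae_of_all _ hB)
  have i2 : ∀ W : Rd d → Rd d →L[ℝ] Rd d, IntegrableOn W Ω →
      IntegrableOn (fun x => η x • W x e) Ω := fun W hW =>
    Integrable.bdd_smul ((ContinuousLinearMap.apply ℝ (Rd d) e).integrable_comp hW) E
      hη.1.continuous.aestronglyMeasurable (ae_of_all _ hE)
  simp only [Pi.add_apply, smul_add, add_apply]
  rw [integral_add (i1 _ hH.integrable) (i1 _ hH'.integrable),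
    integral_add (i2 _ hH.integrable_grad) (i2 _ hH'.integrable_grad), hH.weak η hη e,
    hH'.weak η hη e, neg_add]

theorem MemW11.const_smul {Ω : Set (Rd d)} {u : Rd d → Rd d} {H : Rd d → Rd d →L[ℝ] Rd d}
    (hH : MemW11 Ω u H) (c : ℝ) : MemW11 Ω (c • u) (c • H) := by
  refine ⟨hH.integrable.smul c, hH.integrable_grad.smul c, fun η hη e => ?_⟩
  simp only [Pi.smul_apply, smul_apply, smul_comm _ c]
  rw [integral_smul, integral_smul, hH.weak η hη e, smul_neg]

/-! ### Divergence moments of the tangential bubbles -/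

namespace Mesh

variable {M : Mesh d}

/-- `u` is in `W^{1,1}`, and `l` is the family of moments of its divergence. -/
def HasDivMoments (M : Mesh d) (u : Rd d → Rd d) (l : Rd d → ℝ) : Prop :=
  ∃ H, MemW11 M.domain u H ∧ ∀ k, ∫ x in M.domain, divOf H x * M.phi k x = l k

theorem HasDivMoments.zero : M.HasDivMoments 0 0 :=
  ⟨0, ⟨integrable_zero_of_normed, integrable_zero_of_normed, by simp⟩, fun k => by simp [divOf]⟩

theorem HasDivMoments.add {u u' : Rd d → Rd d} {l l' : Rd d → ℝ} (h : M.HasDivMoments u l)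
    (h' : M.HasDivMoments u' l') : M.HasDivMoments (u + u') (l + l') := by
  obtain ⟨H, hH, hl⟩ := h
  obtain ⟨H', hH', hl'⟩ := h'
  refine ⟨H + H', hH.add hH', fun k => ?_⟩
  have hs := M.segLip_phi k
  rw [Pi.add_apply, ← hl, ← hl',
    ← integral_add (hs.integrable_trace_mul isOpen_domain hH.integrable_grad)
      (hs.integrable_trace_mul isOpen_domain hH'.integrable_grad)]
  simp only [divOf_eq_trace, Pi.add_apply, map_add, add_mul]

theorem HasDivMoments.const_smul {u : Rd d → Rd d} {l : Rd d → ℝ} (h : M.HasDivMoments u l)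
    (c : ℝ) : M.HasDivMoments (c • u) (c • l) := by
  obtain ⟨H, hH, hl⟩ := h
  refine ⟨c • H, hH.const_smul c, fun k => ?_⟩
  rw [Pi.smul_apply, ← hl]
  simp only [Pi.smul_apply, divOf_eq_trace, map_smul, smul_eq_mul, mul_assoc]
  rw [integral_const_mul]

theorem HasDivMoments.sum {ι : Type*} (s : Finset ι) {u : ι → Rd d → Rd d} {l : ι → Rd d → ℝ}
    (h : ∀ a ∈ s, M.HasDivMoments (u a) (l a)) :
    M.HasDivMoments (∑ a ∈ s, u a) (∑ a ∈ s, l a) := by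
  classical
  induction s using Finset.induction_on with
  | empty => exact HasDivMoments.zero
  | insert a s ha ih =>
    rw [Finset.sum_insert ha, Finset.sum_insert ha]
    exact (h a (Finset.mem_insert_self a s)).add
      (ih fun b hb => h b (Finset.mem_insert_of_mem hb))

open Classical in
/-- The simplices that contain the edge `[i, j]`. -/
def edgeStar (M : Mesh d) (i j : Rd d) : Finset (Finset (Rd d)) :=
  M.elements.filter fun T => i ∈ T ∧ j ∈ T

theorem mem_edgeStar {i j : Rd d} {T : Finset (Rd d)} :
    T ∈ M.edgeStar i j ↔ T ∈ M.simplices ∧ i ∈ T ∧ j ∈ T := by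
  simp [edgeStar]

theorem edgePatch_eq (M : Mesh d) (i j : Rd d) :
    M.edgePatch i j = ⋃ T ∈ M.edgeStar i j, hull T := by
  ext x
  simp only [edgePatch, mem_iUnion, mem_edgeStar, exists_prop]
  rfl

theorem isCompact_edgePatch (M : Mesh d) (i j : Rd d) : IsCompact (M.edgePatch i j) := by
  rw [edgePatch_eq]
  exact Finset.isCompact_biUnion _ fun T _ => isCompact_hull T

theorem volume_edgePatch (M : Mesh d) (i j : Rd d) :
    volume.real (M.edgePatch i j) = ∑ T ∈ M.edgeStar i j, volume.real (hull T) := by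
  have h := integral_biUnion_finset_ae (μ := volume) (f := fun _ => (1 : ℝ)) (M.edgeStar i j)
    (s := hull) (fun T _ => (isClosed_hull T).measurableSet)
    (aedisjoint_hull.mono fun T hT => mem_elements.2 (mem_edgeStar.1 hT).1)
    (fun T _ => continuous_integrableOn_hull continuous_const T)
  rw [← edgePatch_eq] at h
  simpa using h

theorem volume_hull_le_edgePatch {i j : Rd d} {T : Finset (Rd d)} (hT : T ∈ M.simplices)
    (hi : i ∈ T) (hj : j ∈ T) : volume.real (hull T) ≤ volume.real (M.edgePatch i j) := by
  rw [volume_edgePatch]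
  exact Finset.single_le_sum (f := fun T => volume.real (hull T)) (fun _ _ => measureReal_nonneg)
    (mem_edgeStar.2 ⟨hT, hi, hj⟩)

theorem volume_edgePatch_pos {i j : Rd d} (h : M.IsEdge i j) :
    0 < volume.real (M.edgePatch i j) := by
  obtain ⟨-, T, hT, hi, hj⟩ := isEdge_iff.1 h
  exact (isSimplex hT).volume_hull_pos.trans_le (volume_hull_le_edgePatch hT hi hj)

theorem ae_hull_interior (T : Finset (Rd d)) :
    ∀ᵐ x ∂volume.restrict (hull T), x ∈ interior (hull T) := by
  rw [ae_restrict_iff' (isClosed_hull T).measurableSet]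
  filter_upwards [measure_eq_zero_iff_ae_notMem.1 (volume_frontier_hull T)] with x hx hxT
  by_contra hn
  exact hx ⟨subset_closure hxT, hn⟩

open Classical in
/-- The moments of the divergence of a tangential bubble function on one simplex. -/
theorem integral_hull_div_bubble {i j : Rd d} (hij : i ≠ j) {T : Finset (Rd d)}
    (hT : T ∈ M.simplices) (k : Rd d) :
    ∫ x in hull T, fderiv ℝ (fun y => M.phi i y * M.phi j y) x (j - i) * M.phi k x =
      if i ∈ T ∧ j ∈ T then volume.real (hull T) / ((d + 1) * (d + 2)) *
        ((if k = i then 1 else 0) - (if k = j then 1 else 0)) else 0 := by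
  have hS := isSimplex hT
  have h1 : ∫ x in hull T, fderiv ℝ (fun y => M.phi i y * M.phi j y) x (j - i) * M.phi k x =
      ∫ x in hull T, (bary T i x * baryGrad T j (j - i) + bary T j x * baryGrad T i (j - i)) *
        bary T k x := by
    refine integral_congr_ae ?_
    filter_upwards [ae_hull_interior T] with x hx
    have hd : HasFDerivAt (fun y => M.phi i y * M.phi j y) _ x :=
      (hasFDerivAt_phi hT hx i).mul (hasFDerivAt_phi hT hx j)
    have hx' := interior_subset hx
    rw [hd.fderiv, phi_eq_bary hT hx', phi_eq_bary hT hx', phi_eq_bary hT hx']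
    simp
  rw [h1]
  by_cases hi : i ∈ T
  swap
  · simp [hi, bary_of_notMem hi, baryGrad_of_notMem hi]
  by_cases hj : j ∈ T
  swap
  · simp [hj, bary_of_notMem hj, baryGrad_of_notMem hj]
  -- Along the edge the slopes are 1 and -1, so the integrand becomes `(λ_i - λ_j) λ_k`. Its
  -- integral is a difference of second moments: only the diagonal excess at `k = i` or `k = j`
  -- survives.
  rw [if_pos ⟨hi, hj⟩, hS.baryGrad_edge hi hj, hS.baryGrad_edge hi hj]
  simp only [if_true, hij, hij.symm, if_false, sub_zero, zero_sub, mul_one, mul_neg,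
    ← sub_eq_add_neg, sub_mul]
  have ci := continuous_bary T i
  have cj := continuous_bary T j
  have ck := continuous_bary T k
  rw [integral_sub (continuous_integrableOn_hull (by fun_prop) T)
    (continuous_integrableOn_hull (by fun_prop) T)]
  by_cases hk : k ∈ T
  swap
  · have hki : k ≠ i := fun h => hk (h ▸ hi)
    have hkj : k ≠ j := fun h => hk (h ▸ hj)
    simp [bary_of_notMem hk, hki, hkj]
  by_cases hki : k = i
  · subst hki
    rw [hS.integral_bary_sq hi, hS.integral_bary_mul hj hi hij.symm]
    simp only [if_true, hij, if_false]
    ring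
  by_cases hkj : k = j
  · subst hkj
    rw [hS.integral_bary_sq hj, hS.integral_bary_mul hi hj hij]
    simp only [if_true, hij.symm, if_false]
    ring
  rw [hS.integral_bary_mul hi hk (Ne.symm hki), hS.integral_bary_mul hj hk (Ne.symm hkj)]
  simp [hki, hkj]

open Classical in
/-- The moments of the divergence of the normalized tangential bubble functions. -/
theorem hasDivMoments_b {i j : Rd d} (h : M.IsEdge i j) :
    M.HasDivMoments (M.b i j)
      (fun k => (if k = i then 1 else 0) - (if k = j then 1 else 0)) := by
  have hs : SegLip M.domain (fun y => M.phi i y * M.phi j y) :=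
    (M.segLip_phi i).mul (M.segLip_phi j)
  have hw := memW11_smul_const isOpen_domain hs (j - i)
  have hb : M.HasDivMoments (M.bubble i j) (fun k =>
      volume.real (M.edgePatch i j) / ((d + 1) * (d + 2)) *
        ((if k = i then 1 else 0) - (if k = j then 1 else 0))) := by
    refine ⟨_, hw, fun k => ?_⟩
    have hint := (M.segLip_phi k).integrable_trace_mul isOpen_domain hw.integrable_grad
    rw [integral_domain_eq_sum hint]
    simp only [divOf_eq_trace, traceCLM_smulRight]
    rw [Finset.sum_congr rfl fun T hT => integral_hull_div_bubble h.ne (mem_elements.1 hT) k,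
      ← Finset.sum_filter, volume_edgePatch, Finset.sum_div, Finset.sum_mul]
    rfl
  have hc := hb.const_smul (((2 + d)! : ℝ) / ((d ! : ℝ) * volume.real (M.edgePatch i j)))
  refine (congrArg (M.HasDivMoments (M.b i j)) ?_).mpr hc
  funext k
  have hV := (volume_edgePatch_pos h).ne'
  have hf : ((2 + d)! : ℝ) = (d + 1) * (d + 2) * d ! := by
    rw [add_comm 2 d, Nat.factorial_succ, Nat.factorial_succ]
    push_cast
    ring
  have hd0 : (d ! : ℝ) ≠ 0 := by positivity
  rw [Pi.smul_apply, smul_eq_mul, hf, ← mul_assoc]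
  -- The normalization of `b` is made for this: `(2 + d)! / d!` cancels the denominator of the
  -- second moments.
  rw [show ((d : ℝ) + 1) * (d + 2) * d ! / (d ! * volume.real (M.edgePatch i j)) *
    (volume.real (M.edgePatch i j) / ((d + 1) * (d + 2))) = 1 by field_simp, one_mul]

-- The detour telescopes: `(δ_i - δ_m) + (δ_m - δ_j) = δ_i - δ_j`. Boundary bubbles are thus avoided
-- without changing any moment.
open Classical in
theorem hasDivMoments_psi {m : Rd d → Rd d → Rd d} (hm : M.IsChoice m) {i j : Rd d}
    (h : M.IsEdge i j) :
    M.HasDivMoments (M.psi m i j)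
      (fun k => (if k = i then 1 else 0) - (if k = j then 1 else 0)) := by
  rw [psi]
  split_ifs with hbd
  · obtain ⟨-, -, -, h1, h2⟩ := hm i j hbd
    convert (hasDivMoments_b h1.1).add (hasDivMoments_b h2.symm.1) using 1
    funext k
    simp
  · exact hasDivMoments_b h

/-! ### The coefficients of `Π₂` -/

/-- The coefficient `⟨φ_i v, ∇φ_j⟩`. -/
def coef (M : Mesh d) (v : Rd d → Rd d) (i j : Rd d) : ℝ :=
  ∫ x in M.domain, inner ℝ (M.phi i x • v x) (gradient (M.phi j) x)

theorem coef_eq (M : Mesh d) (v : Rd d → Rd d) (i j : Rd d) :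
    M.coef v i j = ∫ x in M.domain, M.phi i x * fderiv ℝ (M.phi j) x (v x) := by
  simp only [coef, inner_gradient_phi, map_smul, smul_eq_mul]

theorem integrable_coef {v : Rd d → Rd d} (hv : IntegrableOn v M.domain) (i j : Rd d) :
    IntegrableOn (fun x => M.phi i x * fderiv ℝ (M.phi j) x (v x)) M.domain :=
  (M.segLip_phi i).integrable_mul isOpen_domain
    ((M.segLip_phi j).integrable_fderiv_apply isOpen_domain hv)

theorem coef_add {v w : Rd d → Rd d} (hv : IntegrableOn v M.domain)
    (hw : IntegrableOn w M.domain) (i j : Rd d) :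
    M.coef (v + w) i j = M.coef v i j + M.coef w i j := by
  simp only [coef_eq]
  rw [← integral_add (integrable_coef hv i j) (integrable_coef hw i j)]
  simp only [Pi.add_apply, map_add, mul_add]

theorem coef_smul (c : ℝ) (v : Rd d → Rd d) (i j : Rd d) :
    M.coef (c • v) i j = c * M.coef v i j := by
  simp only [coef_eq]
  rw [← integral_const_mul]
  simp only [Pi.smul_apply, map_smul, smul_eq_mul, mul_left_comm]

theorem coef_congr {v w : Rd d → Rd d} (h : v =ᵐ[volume.restrict M.domain] w) (i j : Rd d) :
    M.coef v i j = M.coef w i j := by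
  refine integral_congr_ae ?_
  filter_upwards [h] with x hx
  rw [hx]

open Classical in
theorem pi2_eq (M : Mesh d) (m : Rd d → Rd d → Rd d) (v : Rd d → Rd d) :
    M.Pi2 m v = ∑ i ∈ M.nodes, ∑ j ∈ M.nodes with M.IsEdge i j,
      (-M.coef v i j) • M.psi m j i := by
  simp only [Pi2, Pi2Node, ← Finset.sum_neg_distrib, ← neg_smul]
  rfl

/-- The supports of `φ_i` and `∇φ_j` share no simplex. This allows sums over neighbours to be
replaced by sums over all nodes. -/
theorem coef_eq_zero (v : Rd d → Rd d) {i j : Rd d} (hij : i ≠ j) (h : ¬ M.IsEdge i j) :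
    M.coef v i j = 0 := by
  rw [coef_eq]
  refine integral_eq_zero_of_ae ?_
  filter_upwards [ae_mem_interior (M := M)] with x hx
  obtain ⟨T, hT, hxT⟩ := hx
  rw [phi_eq_bary hT (interior_subset hxT), (hasFDerivAt_phi hT hxT j).fderiv]
  by_cases hi : i ∈ T
  · by_cases hj : j ∈ T
    · exact absurd (isEdge_iff.2 ⟨hij, T, hT, hi, hj⟩) h
    · simp [baryGrad_of_notMem hj]
  · simp [bary_of_notMem hi]

theorem sum_coef_left {v : Rd d → Rd d} (hv : IntegrableOn v M.domain) (k : Rd d) :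
    ∑ i ∈ M.nodes, M.coef v i k = ∫ x in M.domain, fderiv ℝ (M.phi k) x (v x) := by
  simp only [coef_eq]
  rw [← integral_finsetSum _ fun i _ => integrable_coef hv i k]
  refine setIntegral_congr_fun isOpen_domain.measurableSet fun x hx => ?_
  simp only [← Finset.sum_mul, sum_phi (domain_subset_space hx), one_mul]

/-- The differentiated partition of unity: inside each simplex the gradients of all nodal functions
add up to zero. -/
theorem sum_coef_right {v : Rd d → Rd d} (hv : IntegrableOn v M.domain) (k : Rd d) :
    ∑ j ∈ M.nodes, M.coef v k j = 0 := by
  simp only [coef_eq]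
  rw [← integral_finsetSum _ fun i _ => integrable_coef hv k i]
  refine integral_eq_zero_of_ae ?_
  filter_upwards [ae_mem_interior (M := M)] with x hx
  obtain ⟨T, hT, hxT⟩ := hx
  have h1 : HasFDerivAt (fun y => ∑ j ∈ M.nodes, M.phi j y) (∑ j ∈ M.nodes, baryGrad T j) x :=
    HasFDerivAt.fun_sum fun j _ => hasFDerivAt_phi hT hxT j
  have h2 : (fun y => ∑ j ∈ M.nodes, M.phi j y) =ᶠ[𝓝 x] fun _ => 1 := by
    filter_upwards [mem_interior_iff_mem_nhds.1 hxT] with y hy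
    exact sum_phi (hull_subset_space hT hy)
  have h3 := h1.unique ((hasFDerivAt_const (1 : ℝ) x).congr_of_eventuallyEq h2)
  have h4 := congrArg (fun L : Rd d →L[ℝ] ℝ => L (v x)) h3
  simp only [FunLike.coe_sum, Finset.sum_apply, zero_apply] at h4
  simp only [(hasFDerivAt_phi hT hxT _).fderiv, ← Finset.mul_sum, h4, mul_zero, Pi.zero_apply]

/-- The operator `Π₂` preserves the discrete divergence. -/
theorem pi2_divergence {m : Rd d → Rd d → Rd d} (hm : M.IsChoice m) {v : Rd d → Rd d}
    {G : Rd d → Rd d →L[ℝ] Rd d} (hv : MemW110 M.domain v G) :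
    ∃ H, MemW11 M.domain (M.Pi2 m v) H ∧
      ∀ k ∈ M.nodes, ∫ x in M.domain, divOf H x * M.phi k x =
        ∫ x in M.domain, divOf G x * M.phi k x := by
  classical
  have h : M.HasDivMoments (M.Pi2 m v) (∑ i ∈ M.nodes, ∑ j ∈ M.nodes with M.IsEdge i j,
      (-M.coef v i j) • fun k => (if k = j then (1 : ℝ) else 0) - (if k = i then 1 else 0)) := by
    rw [pi2_eq]
    refine HasDivMoments.sum _ fun i _ => HasDivMoments.sum _ fun j hj => ?_
    exact (hasDivMoments_psi hm (Finset.mem_filter.1 hj).2.symm).const_smul _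
  obtain ⟨H, hH, hl⟩ := h
  refine ⟨H, hH, fun k hk => ?_⟩
  rw [hl k, (M.segLip_phi k).integral_div isOpen_domain hv, ← sum_coef_left hv.integrable k]
  -- Pairs that are not edges may be added: for `i = j` the two deltas cancel, otherwise the
  -- coefficient is zero.
  have hterm : ∀ i ∈ M.nodes, ∑ j ∈ M.nodes with M.IsEdge i j, -M.coef v i j *
      ((if k = j then (1 : ℝ) else 0) - (if k = i then 1 else 0)) =
      ∑ j ∈ M.nodes, -M.coef v i j *
        ((if k = j then (1 : ℝ) else 0) - (if k = i then 1 else 0)) := by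
    intro i _
    rw [Finset.sum_filter]
    refine Finset.sum_congr rfl fun j _ => ?_
    by_cases hE : M.IsEdge i j
    · rw [if_pos hE]
    · rw [if_neg hE]
      by_cases hij : i = j
      · simp [hij]
      · simp [coef_eq_zero v hij hE]
  simp only [Finset.sum_apply, Pi.smul_apply, smul_eq_mul]
  rw [Finset.sum_congr rfl hterm]
  simp only [mul_sub, Finset.sum_sub_distrib, mul_ite, mul_one, mul_zero, Finset.sum_ite_eq, hk,
    if_true, Finset.sum_neg_distrib]
  -- Exchanging the sums lets the delta in the first index collapse; it leaves the sum of `coef v k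
  -- j` over `j`, which is zero.
  rw [Finset.sum_comm]
  simp only [Finset.sum_ite_eq, hk, if_true, Finset.sum_neg_distrib,
    sum_coef_right hv.integrable k, neg_zero, sub_zero]

end Mesh

end Fortin

/-! ### Geometric consequences of shape regularity -/

namespace Fortin

namespace IsSimplex

open Mesh

variable {d : ℕ} {T : Finset (Rd d)}

/-- The coordinate has values in `[0, 1]` on the simplex, so it changes by at most 1 from the centre
of the ball to its boundary in any direction. -/
theorem norm_baryGrad_le (hT : IsSimplex T) {x : Rd d} {r : ℝ} (hr : 0 < r)
    (hball : Metric.closedBall x r ⊆ hull T) (k : Rd d) : ‖baryGrad T k‖ ≤ 1 / r := by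
  refine ContinuousLinearMap.opNorm_le_bound _ (by positivity) fun w => ?_
  rcases eq_or_ne w 0 with rfl | hw
  · simp
  have hw' : 0 < ‖w‖ := norm_pos_iff.2 hw
  have h1 : x + (r / ‖w‖) • w ∈ hull T := hball (by
    rw [Metric.mem_closedBall, dist_eq_norm, add_sub_cancel_left, norm_smul, Real.norm_eq_abs,
      abs_of_pos (by positivity), div_mul_cancel₀ _ hw'.ne'])
  have h2 : x ∈ hull T := hball (Metric.mem_closedBall_self hr.le)
  have h3 := bary_add T k x ((r / ‖w‖) • w)
  rw [map_smul, smul_eq_mul] at h3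
  have h4 : |r / ‖w‖ * baryGrad T k w| ≤ 1 := abs_le.2
    ⟨by linarith [hT.bary_nonneg h1 k, hT.bary_le_one h2 k],
      by linarith [hT.bary_nonneg h2 k, hT.bary_le_one h1 k]⟩
  rw [abs_mul, abs_of_pos (by positivity : 0 < r / ‖w‖)] at h4
  rw [Real.norm_eq_abs]
  calc |baryGrad T k w| = (1 / r * ‖w‖) * (r / ‖w‖ * |baryGrad T k w|) := by field_simp
    _ ≤ (1 / r * ‖w‖) * 1 := by gcongr
    _ = 1 / r * ‖w‖ := mul_one _

/-- The coordinate of `j` rises from 0 to 1 along the edge, while its slope is at most `1 / r`. -/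
theorem inradius_le_edge (hT : IsSimplex T) {x : Rd d} {r : ℝ} (hr : 0 < r)
    (hball : Metric.closedBall x r ⊆ hull T) {i j : Rd d} (hi : i ∈ T) (hj : j ∈ T)
    (hij : i ≠ j) : r ≤ ‖j - i‖ := by
  have h1 := (baryGrad T j).le_of_opNorm_le (hT.norm_baryGrad_le hr hball j) (j - i)
  rw [hT.baryGrad_edge hi hj] at h1
  simp only [if_true, hij.symm, if_false, sub_zero, norm_one] at h1
  rw [one_div, ← div_eq_inv_mul, le_div_iff₀ hr, one_mul] at h1
  exact h1

theorem exists_ne_mem (hT : IsSimplex T) (hd : 1 ≤ d) (i : Rd d) :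
    ∃ j ∈ T, j ≠ i := by
  have : 1 < T.card := by rw [hT.card]; omega
  exact Finset.exists_mem_ne this i

end IsSimplex

namespace Mesh

variable {d : ℕ} {M : Mesh d} {κ : ℝ}

theorem norm_sub_le_diam {T : Finset (Rd d)} {x y : Rd d} (hx : x ∈ hull T) (hy : y ∈ hull T) :
    ‖x - y‖ ≤ Metric.diam (hull T) := by
  rw [← dist_eq_norm]
  exact Metric.dist_le_diam_of_mem (isCompact_hull T).isBounded hx hy

theorem inradius_le_diam (hd : 1 ≤ d) {T : Finset (Rd d)} (hT : IsSimplex T) {x : Rd d} {r : ℝ}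
    (hr : 0 < r) (hball : Metric.closedBall x r ⊆ hull T) : r ≤ Metric.diam (hull T) := by
  obtain ⟨i, hi⟩ : T.Nonempty := Finset.card_pos.1 (by rw [hT.card]; omega)
  obtain ⟨j, hj, hji⟩ := hT.exists_ne_mem hd i
  exact (hT.inradius_le_edge hr hball hi hj hji.symm).trans
    (norm_sub_le_diam (mem_hull hj) (mem_hull hi))

namespace ShapeRegular

variable (h : M.ShapeRegular κ) (hd : 1 ≤ d) {T : Finset (Rd d)} (hT : T ∈ M.simplices)
include h hd hT

theorem one_le : 1 ≤ κ := by
  obtain ⟨x, r, hr, hball, hdiam⟩ := h T hT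
  have := inradius_le_diam hd (isSimplex hT) hr hball
  by_contra! hlt
  nlinarith

theorem diam_pos : 0 < Metric.diam (hull T) := by
  obtain ⟨x, r, hr, hball, hdiam⟩ := h T hT
  exact hr.trans_le (inradius_le_diam hd (isSimplex hT) hr hball)

theorem diam_le_edge {i j : Rd d} (hi : i ∈ T) (hj : j ∈ T) (hij : i ≠ j) :
    Metric.diam (hull T) ≤ κ * ‖j - i‖ := by
  obtain ⟨x, r, hr, hball, hdiam⟩ := h T hT
  have h1 := h.one_le hd hT
  exact hdiam.trans (by
    gcongr
    exact (isSimplex hT).inradius_le_edge hr hball hi hj hij)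

theorem norm_baryGrad_le_div {i j : Rd d} (hi : i ∈ T) (hj : j ∈ T) (hij : i ≠ j) (k : Rd d) :
    ‖baryGrad T k‖ ≤ κ / ‖j - i‖ := by
  obtain ⟨x, r, hr, hball, hdiam⟩ := h T hT
  have h1 := h.one_le hd hT
  refine ((isSimplex hT).norm_baryGrad_le hr hball k).trans ?_
  have h2 : 0 < ‖j - i‖ := norm_pos_iff.2 (sub_ne_zero.2 hij.symm)
  rw [div_le_div_iff₀ hr h2, one_mul]
  exact (norm_sub_le_diam (mem_hull hj) (mem_hull hi)).trans hdiam

/-- The volume of a set in a ball is controlled by the volume of a simplex of comparable size. -/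
theorem volume_le {P : Set (Rd d)} {x₀ : Rd d} {c : ℝ} (hc : 0 ≤ c)
    (hP : P ⊆ Metric.closedBall x₀ (c * Metric.diam (hull T))) :
    volume.real P ≤ (c * κ) ^ d * volume.real (hull T) := by
  obtain ⟨x, r, hr, hball, hdiam⟩ := h T hT
  have h1 := h.one_le hd hT
  have hfin : volume (Metric.closedBall x₀ (c * Metric.diam (hull T))) ≠ ⊤ :=
    (isCompact_closedBall _ _).measure_lt_top.ne
  calc volume.real P ≤ volume.real (Metric.closedBall x₀ (c * Metric.diam (hull T))) :=
        measureReal_mono hP hfin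
    _ = (c * Metric.diam (hull T)) ^ d * volume.real (Metric.ball (0 : Rd d) 1) := by
        rw [Measure.addHaar_real_closedBall _ _ (mul_nonneg hc Metric.diam_nonneg)]
        simp
    _ ≤ (c * (κ * r)) ^ d * volume.real (Metric.ball (0 : Rd d) 1) := by
        gcongr
    _ = (c * κ) ^ d * volume.real (Metric.closedBall x r) := by
        rw [Measure.addHaar_real_closedBall _ _ hr.le]
        simp only [finrank_euclideanSpace, Fintype.card_fin]
        ring
    _ ≤ (c * κ) ^ d * volume.real (hull T) := by
        gcongr
        exact (isCompact_hull T).measure_lt_top.ne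

/-- Scaling a simplex towards a vertex. -/
theorem exists_closedBall_subset {j : Rd d} (hj : j ∈ T) {h₀ : ℝ} (hh₀ : 0 < h₀)
    (hle : h₀ ≤ Metric.diam (hull T)) :
    ∃ c, Metric.closedBall c (h₀ / κ) ⊆ hull T ∩ Metric.closedBall j h₀ := by
  obtain ⟨x, r, hr, hball, hdiam⟩ := h T hT
  have hκ := h.one_le hd hT
  set D := Metric.diam (hull T) with hD
  have hD0 : 0 < D := hh₀.trans_le hle
  -- The homothety with centre `j` and ratio `t` shrinks the diameter `D` to `h₀`, and the inner
  -- ball of radius at least `D / κ` to one of radius at least `h₀ / κ`.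
  set t := h₀ / D with ht
  have ht0 : 0 < t := by positivity
  have ht1 : t ≤ 1 := (div_le_one hD0).2 hle
  refine ⟨j + t • (x - j), fun y hy => ?_⟩
  rw [Metric.mem_closedBall, dist_eq_norm] at hy
  set z := j + t⁻¹ • (y - j) with hz
  have hyz : y - j = t • (z - j) := by
    rw [hz, add_sub_cancel_left, smul_smul, mul_inv_cancel₀ ht0.ne', one_smul]
  have hzT : z ∈ hull T := by
    refine hball ?_
    rw [Metric.mem_closedBall, dist_eq_norm]
    have e : z - x = t⁻¹ • (y - (j + t • (x - j))) := by
      rw [← sub_sub, smul_sub, smul_smul, inv_mul_cancel₀ ht0.ne', one_smul, hz]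
      abel
    rw [e, norm_smul, Real.norm_eq_abs, abs_of_pos (inv_pos.2 ht0)]
    calc t⁻¹ * ‖y - (j + t • (x - j))‖ ≤ t⁻¹ * (h₀ / κ) := by gcongr
      _ = D / κ := by rw [ht]; field_simp
      _ ≤ r := by rw [div_le_iff₀ (by linarith)]; linarith
  have hjT := mem_hull hj
  constructor
  · have : y = (1 - t) • j + t • z := by
      have := eq_add_of_sub_eq hyz
      rw [this, smul_sub, sub_smul, one_smul]
      abel
    rw [this]
    exact convex_hull T hjT hzT (by linarith) ht0.le (by ring)
  · rw [Metric.mem_closedBall, dist_eq_norm, hyz, norm_smul, Real.norm_eq_abs, abs_of_pos ht0]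
    calc t * ‖z - j‖ ≤ t * D := by
          gcongr
          exact norm_sub_le_diam hzT hjT
      _ = h₀ := by rw [ht]; field_simp

end ShapeRegular

open Classical in
/-- The simplices that contain the vertex `j`. -/
def star (M : Mesh d) (j : Rd d) : Finset (Finset (Rd d)) :=
  M.elements.filter fun T => j ∈ T

theorem mem_star {j : Rd d} {T : Finset (Rd d)} : T ∈ M.star j ↔ T ∈ M.simplices ∧ j ∈ T := by
  simp [star]

/-- The number of simplices at a vertex is bounded. -/
theorem ShapeRegular.card_star_le (h : M.ShapeRegular κ) (hd : 1 ≤ d) {j : Rd d}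
    (hj : (M.star j).Nonempty) : ((M.star j).card : ℝ) ≤ κ ^ d := by
  -- With `h₀` the smallest diameter at `j`, every simplex at `j` contains a ball of radius `h₀ / κ`
  -- within distance `h₀` of `j`. Comparing volumes bounds their number, with no prior comparison of
  -- the diameters.
  obtain ⟨T₀, hT₀, hmin⟩ := (M.star j).exists_min_image (fun T => Metric.diam (hull T)) hj
  have hκ := h.one_le hd (mem_star.1 hT₀).1
  set h₀ := Metric.diam (hull T₀) with hh₀
  have hpos : 0 < h₀ := h.diam_pos hd (mem_star.1 hT₀).1
  set β := volume.real (Metric.ball (0 : Rd d) 1) with hβ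
  have hβ0 : 0 < β := by
    rw [hβ, Measure.real, ENNReal.toReal_pos_iff]
    exact ⟨Metric.measure_ball_pos _ _ one_pos, measure_ball_lt_top⟩
  have hsum : ∑ T ∈ M.star j, volume.real (hull T ∩ Metric.closedBall j h₀) ≤
      volume.real (Metric.closedBall j h₀) := by
    have h1 := integral_biUnion_finset_ae (μ := volume) (f := fun _ => (1 : ℝ)) (M.star j)
      (s := fun T => hull T ∩ Metric.closedBall j h₀)
      (fun T _ => (isClosed_hull T).measurableSet.inter Metric.isClosed_closedBall.measurableSet)
      (fun T hT T' hT' hne => (aedisjoint_hull (mem_elements.2 (mem_star.1 hT).1)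
        (mem_elements.2 (mem_star.1 hT').1) hne).mono inter_subset_left inter_subset_left)
      (fun T _ => (continuous_integrableOn_hull continuous_const T).mono_set inter_subset_left)
    simp only [integral_const, MeasurableSet.univ, measureReal_restrict_apply, univ_inter,
      smul_eq_mul, mul_one] at h1
    rw [← h1]
    exact measureReal_mono (iUnion₂_subset fun T _ => inter_subset_right)
      (isCompact_closedBall _ _).measure_lt_top.ne
  have hterm : ∀ T ∈ M.star j, (h₀ / κ) ^ d * β ≤
      volume.real (hull T ∩ Metric.closedBall j h₀) := by
    intro T hT
    obtain ⟨c, hc⟩ := h.exists_closedBall_subset hd (mem_star.1 hT).1 (mem_star.1 hT).2 hpos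
      (hmin T hT)
    calc (h₀ / κ) ^ d * β = volume.real (Metric.closedBall c (h₀ / κ)) := by
          rw [Measure.addHaar_real_closedBall _ _ (by positivity)]
          simp [hβ]
      _ ≤ _ := measureReal_mono hc
        (((measure_mono inter_subset_right).trans_lt
          (isCompact_closedBall j h₀).measure_lt_top).ne)
  have h2 := (Finset.card_nsmul_le_sum _ _ _ hterm).trans hsum
  rw [Measure.addHaar_real_closedBall _ _ hpos.le, nsmul_eq_mul, finrank_euclideanSpace,
    Fintype.card_fin, div_pow] at h2
  have hp : 0 < h₀ ^ d * β := by positivity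
  have h3 : ((M.star j).card : ℝ) / κ ^ d * (h₀ ^ d * β) ≤ 1 * (h₀ ^ d * β) := by
    calc ((M.star j).card : ℝ) / κ ^ d * (h₀ ^ d * β) =
        (M.star j).card * (h₀ ^ d / κ ^ d * β) := by ring
      _ ≤ h₀ ^ d * β := h2
      _ = _ := (one_mul _).symm
  have h4 := le_of_mul_le_mul_right h3 hp
  rwa [div_le_one (by positivity)] at h4

/-- Around a vertex, the simplices are connected through common edges, unless the domain touches
itself. -/
theorem star_connected (hd : 2 ≤ d) (hB : M.BoundaryLocallyConnected) {j : Rd d}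
    {A : Finset (Finset (Rd d))} (hA : A ⊆ M.star j) (hne : A.Nonempty) (hAs : A ≠ M.star j) :
    ∃ T₁ ∈ A, ∃ T₂ ∈ M.star j, T₂ ∉ A ∧ ∃ k, k ≠ j ∧ k ∈ T₁ ∧ k ∈ T₂ := by
  classical
  by_contra! hcon
  set B := M.star j \ A with hBdef
  have hBne : B.Nonempty := by
    rw [Finset.sdiff_nonempty]
    exact fun hs => hAs (hA.antisymm hs)
  have hBs : B ⊆ M.star j := Finset.sdiff_subset
  set FA : Set (Rd d) := ⋃ T ∈ A, hull T with hFA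
  set FB : Set (Rd d) := ⋃ T ∈ B, hull T with hFB
  have hFAc : IsClosed FA := A.finite_toSet.isClosed_biUnion fun T _ => isClosed_hull T
  have hFBc : IsClosed FB := B.finite_toSet.isClosed_biUnion fun T _ => isClosed_hull T
  -- By conformity two simplices meet in the hull of their common vertices, which is here only `j`.
  have hinter : FA ∩ FB ⊆ {j} := by
    rintro x ⟨hxA, hxB⟩
    obtain ⟨T₁, hT₁, hx₁⟩ := mem_iUnion₂.1 hxA
    obtain ⟨T₂, hT₂, hx₂⟩ := mem_iUnion₂.1 hxB
    have hs₁ := mem_star.1 (hA hT₁)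
    have hs₂ := mem_star.1 (hBs hT₂)
    have := M.complex.inter_subset_convexHull hs₁.1.1 hs₂.1.1 ⟨hx₁, hx₂⟩
    have hsub : (T₁ ∩ T₂ : Set (Rd d)) ⊆ {j} := by
      rintro k ⟨hk₁, hk₂⟩
      by_contra hk
      exact hcon T₁ hT₁ T₂ (hBs hT₂) (Finset.mem_sdiff.1 hT₂).2 k hk hk₁ hk₂
    simpa using convexHull_mono hsub this
  obtain ⟨T₁, hT₁⟩ := hne
  obtain ⟨T₂, hT₂⟩ := hBne
  have hs₁ := mem_star.1 (hA hT₁)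
  have hs₂ := mem_star.1 (hBs hT₂)
  have hjn : j ∈ M.nodes := mem_nodes_iff.2 ⟨T₁, hs₁⟩
  set W : Set (Rd d) := ⋃ T ∈ M.elements \ M.star j, hull T with hW
  have hWc : IsClosed W :=
    (M.elements \ M.star j).finite_toSet.isClosed_biUnion fun T _ => isClosed_hull T
  have hjW : j ∉ W := by
    intro hj
    obtain ⟨T, hT, hjT⟩ := mem_iUnion₂.1 hj
    rw [Finset.mem_sdiff, mem_elements] at hT
    exact hT.2 (mem_star.2 ⟨hT.1, mem_of_mem_hull hjn hT.1 hjT⟩)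
  have hU : Wᶜ ∈ 𝓝 j := hWc.isOpen_compl.mem_nhds hjW
  have hcover : ∀ S : Set (Rd d), S ⊆ M.complex.space → S ⊆ Wᶜ → S ⊆ FA ∪ FB := by
    intro S hS hSW x hx
    obtain ⟨T, hT, hxT⟩ := exists_mem_hull (hS hx)
    by_cases hTs : T ∈ M.star j
    · by_cases hTA : T ∈ A
      · exact Or.inl (mem_biUnion hTA hxT)
      · exact Or.inr (mem_biUnion (Finset.mem_sdiff.2 ⟨hTs, hTA⟩ : T ∈ B) hxT)
    · exact absurd (mem_biUnion (Finset.mem_sdiff.2 ⟨mem_elements.2 hT, hTs⟩ :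
        T ∈ M.elements \ M.star j) hxT) (hSW hx)
  -- A connected subset of the polytope near `j` that avoids `j` cannot meet both groups: they would
  -- cover it by two closed sets that are disjoint away from `j`. It remains to exhibit such a set.
  have main : ∀ S : Set (Rd d), S ⊆ M.complex.space → S ⊆ Wᶜ → j ∉ S → IsPreconnected S →
      (S ∩ hull T₁).Nonempty → (S ∩ hull T₂).Nonempty → False := by
    intro S hS hSW hjS hpre h1 h2
    obtain ⟨x, hxS, hx⟩ := isPreconnected_closed_iff.1 hpre FA FB hFAc hFBc (hcover S hS hSW)
      (h1.mono (inter_subset_inter_right _ fun x hx => mem_biUnion hT₁ hx))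
      (h2.mono (inter_subset_inter_right _ fun x hx => mem_biUnion hT₂ hx))
    exact hjS (hinter hx ▸ hxS)
  by_cases hjd : j ∈ M.domain
  · obtain ⟨ε, hε, hball⟩ := Metric.mem_nhds_iff.1 (inter_mem hU (isOpen_domain.mem_nhds hjd))
    obtain ⟨k₁, hk₁, hkj₁⟩ := (isSimplex hs₁.1).exists_ne_mem (by omega) j
    obtain ⟨k₂, hk₂, hkj₂⟩ := (isSimplex hs₂.1).exists_ne_mem (by omega) j
    have hp₁ : 0 < ‖k₁ - j‖ := norm_pos_iff.2 (sub_ne_zero.2 hkj₁)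
    have hp₂ : 0 < ‖k₂ - j‖ := norm_pos_iff.2 (sub_ne_zero.2 hkj₂)
    -- The radius is small enough for the sphere to stay in the neighbourhood of `j`, and at most
    -- the lengths of the two chosen edges, so that the sphere crosses both of them.
    set ρ := min (ε / 2) (min ‖k₁ - j‖ ‖k₂ - j‖) with hρ
    have hρ0 : 0 < ρ := by positivity
    have hsph : Metric.sphere j ρ ⊆ Wᶜ ∩ M.domain := fun x hx => hball (by
      rw [Metric.mem_sphere] at hx
      rw [Metric.mem_ball, hx]
      exact (min_le_left _ _).trans_lt (half_lt_self hε))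
    have hmeet : ∀ T : Finset (Rd d), j ∈ T → ∀ k ∈ T, 0 < ‖k - j‖ → ρ ≤ ‖k - j‖ →
        (Metric.sphere j ρ ∩ hull T).Nonempty := by
      intro T hjT k hk hpos hle
      refine ⟨j + (ρ / ‖k - j‖) • (k - j), ?_, ?_⟩
      · rw [Metric.mem_sphere, dist_eq_norm, add_sub_cancel_left, norm_smul, Real.norm_eq_abs,
          abs_of_pos (by positivity), div_mul_cancel₀ _ hpos.ne']
      · exact (convex_hull T).add_smul_sub_mem (mem_hull hjT) (mem_hull hk)
          ⟨by positivity, (div_le_one hpos).2 hle⟩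
    -- Spheres are connected because `d ≥ 2`.
    have hrank : 1 < Module.rank ℝ (Rd d) := by
      rw [← Module.finrank_eq_rank, finrank_euclideanSpace, Fintype.card_fin]
      exact_mod_cast hd
    refine main (Metric.sphere j ρ) (fun x hx => domain_subset_space (hsph hx).2)
      (fun x hx => (hsph hx).1) ?_ (isPreconnected_sphere hrank j ρ)
      (hmeet T₁ hs₁.2 k₁ hk₁ hp₁ ((min_le_right _ _).trans (min_le_left _ _)))
      (hmeet T₂ hs₂.2 k₂ hk₂ hp₂ ((min_le_right _ _).trans (min_le_right _ _)))
    rw [Metric.mem_sphere, dist_self]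
    exact hρ0.ne
  · have hcl : ∀ T ∈ M.simplices, j ∈ T → j ∈ closure (interior (hull T)) := fun T hT hj =>
      hull_subset_closure_interior hT (mem_hull hj)
    have hfr : j ∈ frontier M.domain := by
      rw [isOpen_domain.frontier_eq]
      exact ⟨closure_mono (interior_hull_subset_domain hs₁.1) (hcl T₁ hs₁.1 hs₁.2), hjd⟩
    obtain ⟨V, hV, hVU, hpre⟩ := hB j hfr _ hU
    have hmeet : ∀ T ∈ M.simplices, j ∈ T → (V ∩ M.domain ∩ hull T).Nonempty := by
      intro T hT hj
      obtain ⟨x, hxV, hxT⟩ := mem_closure_iff_nhds.1 (hcl T hT hj) V hV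
      exact ⟨x, ⟨hxV, interior_hull_subset_domain hT hxT⟩, interior_subset hxT⟩
    exact main (V ∩ M.domain) (inter_subset_right.trans domain_subset_space)
      (inter_subset_left.trans hVU) (fun hj => hjd hj.2) hpre (hmeet T₁ hs₁.1 hs₁.2)
      (hmeet T₂ hs₂.1 hs₂.2)

/-- The bound for the ratio of the diameters of two simplices with a common vertex. -/
def diamRatio (d : ℕ) (κ : ℝ) : ℝ := κ ^ ⌈κ ^ d⌉₊

/-- Simplices with a common vertex have comparable diameters. -/
theorem ShapeRegular.diam_le_of_star (h : M.ShapeRegular κ) (hd : 2 ≤ d)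
    (hB : M.BoundaryLocallyConnected) {j : Rd d} {T T' : Finset (Rd d)} (hT : T ∈ M.star j)
    (hT' : T' ∈ M.star j) :
    Metric.diam (hull T') ≤ diamRatio d κ * Metric.diam (hull T) := by
  classical
  have hκ := h.one_le (by omega) (mem_star.1 hT).1
  -- Passing to a simplex with a common edge costs one factor `κ`. By `star_connected`, the sets `A
  -- n` grow strictly until they exhaust the star.
  set A : ℕ → Finset (Finset (Rd d)) := fun n =>
    (M.star j).filter fun S => Metric.diam (hull S) ≤ κ ^ n * Metric.diam (hull T) with hAdef
  have hmemA : ∀ n S, S ∈ A n ↔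
      S ∈ M.star j ∧ Metric.diam (hull S) ≤ κ ^ n * Metric.diam (hull T) := fun n S =>
    Finset.mem_filter
  have hsubA : ∀ n, A n ⊆ M.star j := fun n => Finset.filter_subset _ _
  have hmono : ∀ n, A n ⊆ A (n + 1) := by
    intro n S hS
    rw [hmemA] at hS ⊢
    refine ⟨hS.1, hS.2.trans ?_⟩
    exact mul_le_mul_of_nonneg_right (pow_le_pow_right₀ hκ (Nat.le_succ n)) Metric.diam_nonneg
  have hgrow : ∀ n, n + 1 ≤ (A n).card ∨ A n = M.star j := by
    intro n
    induction n with
    | zero =>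
      left
      rw [zero_add, Nat.one_le_iff_ne_zero, Finset.card_ne_zero]
      exact ⟨T, (hmemA 0 T).2 ⟨hT, by simp⟩⟩
    | succ n ih =>
      by_cases hs : A n = M.star j
      · right
        exact (hsubA _).antisymm (hs.symm.subset.trans (hmono n))
      · left
        have hc := ih.resolve_right hs
        obtain ⟨T₁, hT₁, T₂, hT₂, hn, k, hkj, hk₁, hk₂⟩ := star_connected hd hB
          (hsubA n)
          (Finset.card_pos.1 (by omega)) hs
        have hT₁' := (hmemA n T₁).1 hT₁
        have hlt : A n ⊂ A (n + 1) := by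
          refine Finset.ssubset_iff_subset_ne.2 ⟨hmono n, fun he => hn ?_⟩
          rw [he, hmemA]
          refine ⟨hT₂, ?_⟩
          calc Metric.diam (hull T₂) ≤ κ * ‖k - j‖ :=
                h.diam_le_edge (by omega) (mem_star.1 hT₂).1 (mem_star.1 hT₂).2 hk₂ hkj.symm
            _ ≤ κ * Metric.diam (hull T₁) := by
                gcongr
                exact norm_sub_le_diam (mem_hull hk₁) (mem_hull (mem_star.1 hT₁'.1).2)
            _ ≤ κ * (κ ^ n * Metric.diam (hull T)) := by
                gcongr
                exact hT₁'.2
            _ = κ ^ (n + 1) * Metric.diam (hull T) := by ring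
        have := Finset.card_lt_card hlt
        omega
  have hcard : (M.star j).card ≤ ⌈κ ^ d⌉₊ := by
    have := (h.card_star_le (by omega) ⟨T, hT⟩).trans (Nat.le_ceil _)
    exact_mod_cast this
  -- At this index the other alternative would give one simplex more than the star can have.
  have hall : A ⌈κ ^ d⌉₊ = M.star j := by
    refine (hgrow _).resolve_left fun hc => ?_
    have := Finset.card_le_card (hsubA ⌈κ ^ d⌉₊)
    omega
  have := (hall ▸ hT' : T' ∈ A ⌈κ ^ d⌉₊)
  exact ((hmemA _ _).1 this).2

end Mesh

end Fortin

/-! ### Local stability -/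

namespace Fortin

namespace Mesh

variable {d : ℕ} {M : Mesh d} {κ : ℝ}

theorem integrableOn_space {v : Rd d → Rd d} (hv : IntegrableOn v M.domain) :
    IntegrableOn v M.complex.space := by
  rwa [IntegrableOn, ← restrict_domain_eq_restrict_space]

theorem edgePatch_subset_space (M : Mesh d) (i j : Rd d) : M.edgePatch i j ⊆ M.complex.space :=
  iUnion₂_subset fun _ hT => hull_subset_space hT.1

theorem integral_norm_mono {v : Rd d → Rd d} (hv : IntegrableOn v M.domain) {A B : Set (Rd d)}
    (hAB : A ⊆ B) (hB : B ⊆ M.complex.space) : ∫ x in A, ‖v x‖ ≤ ∫ x in B, ‖v x‖ :=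
  setIntegral_mono_set ((integrableOn_space hv).mono_set hB).norm
    (ae_of_all _ fun _ => norm_nonneg _) hAB.eventuallyLE

/-- The integrand vanishes outside the edge patch. On it `φ_i` is at most 1 and the gradient is
bounded through the length of that same edge. -/
theorem ShapeRegular.abs_coef_le (h : M.ShapeRegular κ) (hd : 1 ≤ d) {v : Rd d → Rd d}
    (hv : IntegrableOn v M.domain) {i j : Rd d} (hij : M.IsEdge i j) :
    |M.coef v i j| ≤ κ / ‖j - i‖ * ∫ x in M.edgePatch i j, ‖v x‖ := by
  obtain ⟨-, T₀, hT₀, -, -⟩ := isEdge_iff.1 hij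
  have hκ := h.one_le hd hT₀
  have hmeas : MeasurableSet (M.edgePatch i j) := (M.isCompact_edgePatch i j).measurableSet
  have hvs := integrableOn_space hv
  have hind : IntegrableOn ((M.edgePatch i j).indicator fun x => κ / ‖j - i‖ * ‖v x‖)
      M.complex.space := (hvs.norm.const_mul _).indicator hmeas
  rw [coef_eq, restrict_domain_eq_restrict_space]
  calc |∫ x in M.complex.space, M.phi i x * fderiv ℝ (M.phi j) x (v x)|
      ≤ ∫ x in M.complex.space, (M.edgePatch i j).indicator
          (fun x => κ / ‖j - i‖ * ‖v x‖) x := by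
        rw [← Real.norm_eq_abs]
        refine norm_integral_le_of_norm_le hind ?_
        rw [← restrict_domain_eq_restrict_space]
        filter_upwards [ae_mem_interior (M := M)] with x hx
        obtain ⟨T, hT, hxT⟩ := hx
        have hxT' := interior_subset hxT
        rw [phi_eq_bary hT hxT', (hasFDerivAt_phi hT hxT j).fderiv]
        have h0 : 0 ≤ (M.edgePatch i j).indicator (fun x => κ / ‖j - i‖ * ‖v x‖) x :=
          indicator_nonneg (fun _ _ => by positivity) x
        by_cases hi : i ∈ T
        swap
        · simpa [bary_of_notMem hi] using h0
        by_cases hj : j ∈ T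
        swap
        · simpa [baryGrad_of_notMem hj] using h0
        have hmem : x ∈ M.edgePatch i j := by
          rw [edgePatch_eq]
          exact mem_biUnion (mem_edgeStar.2 ⟨hT, hi, hj⟩) hxT'
        rw [indicator_of_mem hmem, norm_mul]
        calc ‖bary T i x‖ * ‖baryGrad T j (v x)‖ ≤ 1 * (κ / ‖j - i‖ * ‖v x‖) := by
              have hS := isSimplex hT
              gcongr
              · rw [Real.norm_eq_abs, abs_of_nonneg (hS.bary_nonneg hxT' i)]
                exact hS.bary_le_one hxT' i
              · exact (baryGrad T j).le_of_opNorm_le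
                  (h.norm_baryGrad_le_div hd hT hi hj hij.ne j) _
          _ = _ := one_mul _
    _ = κ / ‖j - i‖ * ∫ x in M.edgePatch i j, ‖v x‖ := by
        rw [setIntegral_indicator hmeas, inter_eq_right.2 (M.edgePatch_subset_space i j),
          integral_const_mul]

theorem b_eq_zero {T : Finset (Rd d)} (hT : T ∈ M.simplices) {x : Rd d} (hx : x ∈ hull T)
    {i j : Rd d} (h : ¬(i ∈ T ∧ j ∈ T)) : M.b i j x = 0 := by
  rw [b, Pi.smul_apply, bubble, phi_eq_bary hT hx, phi_eq_bary hT hx]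
  by_cases hi : i ∈ T
  · have hj : j ∉ T := fun hj => h ⟨hi, hj⟩
    simp [bary_of_notMem hj]
  · simp [bary_of_notMem hi]

/-- A bubble that is non-zero on `T` has `T` in its patch, so the patch volume in the normalization
may be replaced by that of `T`. -/
theorem norm_b_le {T : Finset (Rd d)} (hT : T ∈ M.simplices) {x : Rd d} (hx : x ∈ hull T)
    (i j : Rd d) : ‖M.b i j x‖ ≤
      (d + 1) * (d + 2) / volume.real (hull T) * Metric.diam (hull T) := by
  have hS := isSimplex hT
  have hV := hS.volume_hull_pos
  by_cases h : i ∈ T ∧ j ∈ T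
  · have hle := volume_hull_le_edgePatch hT h.1 h.2
    have hf : ((2 + d)! : ℝ) = (d + 1) * (d + 2) * d ! := by
      rw [add_comm 2 d, Nat.factorial_succ, Nat.factorial_succ]
      push_cast
      ring
    have hd0 : (d ! : ℝ) ≠ 0 := by positivity
    have hc : ((2 + d)! : ℝ) / (d ! * volume.real (M.edgePatch i j)) =
        (d + 1) * (d + 2) / volume.real (M.edgePatch i j) := by
      rw [hf]
      field_simp
    rw [b, Pi.smul_apply, hc, bubble, norm_smul, norm_smul, phi_eq_bary hT hx,
      phi_eq_bary hT hx, norm_mul]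
    simp only [Real.norm_eq_abs]
    rw [abs_of_nonneg (hS.bary_nonneg hx i), abs_of_nonneg (hS.bary_nonneg hx j),
      abs_of_nonneg (by positivity)]
    calc (d + 1) * (d + 2) / volume.real (M.edgePatch i j) *
          (bary T i x * bary T j x * ‖j - i‖)
        ≤ (d + 1) * (d + 2) / volume.real (hull T) * (1 * 1 * Metric.diam (hull T)) := by
          have h1 := hS.bary_nonneg hx i
          have h2 := hS.bary_nonneg hx j
          have h3 := hS.bary_le_one hx i
          have h4 := hS.bary_le_one hx j
          have h5 := norm_sub_le_diam (mem_hull h.2) (mem_hull h.1)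
          gcongr
      _ = _ := by ring
  · rw [b_eq_zero hT hx h, norm_zero]
    have := Metric.diam_nonneg (s := hull T)
    positivity

theorem psi_eq_zero {m : Rd d → Rd d → Rd d} {T : Finset (Rd d)} (hT : T ∈ M.simplices)
    {x : Rd d} (hx : x ∈ hull T) {i j : Rd d} (hi : i ∉ T) (hj : j ∉ T) :
    M.psi m i j x = 0 := by
  rw [psi]
  split_ifs
  · rw [Pi.add_apply, b_eq_zero hT hx fun h => hi h.1, b_eq_zero hT hx fun h => hj h.2, add_zero]
  · exact b_eq_zero hT hx fun h => hi h.1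

theorem norm_psi_le (m : Rd d → Rd d → Rd d) {T : Finset (Rd d)} (hT : T ∈ M.simplices)
    {x : Rd d} (hx : x ∈ hull T) (i j : Rd d) : ‖M.psi m i j x‖ ≤
      2 * ((d + 1) * (d + 2) / volume.real (hull T) * Metric.diam (hull T)) := by
  have h1 := norm_b_le hT hx i j
  have h0 := (norm_nonneg _).trans h1
  rw [psi]
  split_ifs
  · rw [Pi.add_apply, two_mul]
    exact (norm_add_le _ _).trans (add_le_add (norm_b_le hT hx _ _) (norm_b_le hT hx _ _))
  · linarith

/-- The estimate of one summand of `Π₂`. -/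
theorem ShapeRegular.norm_term_le (h : M.ShapeRegular κ) (hd : 1 ≤ d) (m : Rd d → Rd d → Rd d)
    {v : Rd d → Rd d} (hv : IntegrableOn v M.domain) {T : Finset (Rd d)} (hT : T ∈ M.simplices)
    {x : Rd d} (hx : x ∈ hull T) {i j : Rd d} (hij : M.IsEdge i j) {P : Set (Rd d)}
    (hP : M.edgePatch i j ⊆ P) (hPs : P ⊆ M.complex.space) {Q : ℝ}
    (hQ : Metric.diam (hull T) ≤ Q * ‖j - i‖) :
    ‖((-M.coef v i j) • M.psi m j i) x‖ ≤
      2 * (d + 1) * (d + 2) * κ * Q / volume.real (hull T) * ∫ y in P, ‖v y‖ := by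
  have hκ := h.one_le hd hT
  have hV := (isSimplex hT).volume_hull_pos
  have hn : 0 < ‖j - i‖ := norm_pos_iff.2 (sub_ne_zero.2 hij.ne.symm)
  have hI : 0 ≤ ∫ y in P, ‖v y‖ := integral_nonneg fun _ => norm_nonneg _
  have h1 : |M.coef v i j| ≤ κ / ‖j - i‖ * ∫ y in P, ‖v y‖ :=
    (h.abs_coef_le hd hv hij).trans (mul_le_mul_of_nonneg_left
      (integral_norm_mono hv hP hPs) (by positivity))
  have hc : 0 ≤ ((d : ℝ) + 1) * (d + 2) / volume.real (hull T) := by positivity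
  have h2 : ‖M.psi m j i x‖ ≤
      2 * (((d : ℝ) + 1) * (d + 2) / volume.real (hull T) * (Q * ‖j - i‖)) := by
    have h3 := mul_le_mul_of_nonneg_left hQ hc
    linarith [norm_psi_le m hT hx j i]
  have h4 : 0 ≤ κ / ‖j - i‖ * ∫ y in P, ‖v y‖ := mul_nonneg (by positivity) hI
  rw [Pi.smul_apply, norm_smul, norm_neg, Real.norm_eq_abs]
  -- The edge length cancels between the coefficient and the bubble; only the ratio `Q` remains.
  refine (mul_le_mul h1 h2 (norm_nonneg _) h4).trans (le_of_eq ?_)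
  generalize (∫ y in P, ‖v y‖) = I
  generalize volume.real (hull T) = V at hV
  field_simp

theorem ShapeRegular.card_neighbours_le (h : M.ShapeRegular κ) (hd : 1 ≤ d) {i : Rd d}
    (hi : i ∈ M.nodes) [DecidablePred (M.IsEdge i)] :
    ((M.nodes.filter (M.IsEdge i)).card : ℝ) ≤ (d + 1) * κ ^ d := by
  classical
  obtain ⟨T, hT, hiT⟩ := mem_nodes_iff.1 hi
  have hsub : M.nodes.filter (M.IsEdge i) ⊆ (M.star i).biUnion id := by
    intro j hj
    obtain ⟨-, S, hS, hiS, hjS⟩ := isEdge_iff.1 (Finset.mem_filter.1 hj).2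
    exact Finset.mem_biUnion.2 ⟨S, mem_star.2 ⟨hS, hiS⟩, hjS⟩
  have h1 := (Finset.card_le_card hsub).trans (Finset.card_biUnion_le_card_mul (M.star i) id (d + 1)
    fun S hS => (mem_star.1 hS).1.2.le)
  have h2 := h.card_star_le hd ⟨T, mem_star.2 ⟨hT, hiT⟩⟩
  calc ((M.nodes.filter (M.IsEdge i)).card : ℝ) ≤ (M.star i).card * (d + 1) := by exact_mod_cast h1
    _ ≤ κ ^ d * (d + 1) := by gcongr
    _ = _ := mul_comm _ _

theorem sum_nodes_ite_mem {T : Finset (Rd d)} (hT : T ∈ M.simplices) (D : ℝ)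
    [DecidablePred (· ∈ T)] :
    ∑ i ∈ M.nodes, (if i ∈ T then D else 0) = (d + 1) * D := by
  rw [← Finset.sum_filter]
  have : M.nodes.filter (· ∈ T) = T := by
    ext i
    simp only [Finset.mem_filter, and_iff_right_iff_imp]
    exact fun hi => mem_nodes_iff.2 ⟨T, hT, hi⟩
  rw [this, Finset.sum_const, hT.2, nsmul_eq_mul]
  push_cast
  ring

-- Each edge is charged to its endpoints in `T`: there are `d + 1` of these, each with boundedly
-- many neighbours. The symmetry of the edge relation makes the two charges equal.
open Classical in
theorem ShapeRegular.sum_edges_le (h : M.ShapeRegular κ) (hd : 1 ≤ d) {T : Finset (Rd d)}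
    (hT : T ∈ M.simplices) {D : ℝ} (hD : 0 ≤ D) :
    ∑ i ∈ M.nodes, ∑ j ∈ M.nodes with M.IsEdge i j,
      ((if i ∈ T then D else 0) + (if j ∈ T then D else 0)) ≤
      2 * ((d + 1) * ((d + 1) * κ ^ d * D)) := by
  have h1 : ∑ i ∈ M.nodes, ∑ j ∈ M.nodes with M.IsEdge i j, (if i ∈ T then D else 0) ≤
      (d + 1) * ((d + 1) * κ ^ d * D) := by
    rw [← sum_nodes_ite_mem hT]
    refine Finset.sum_le_sum fun i hi => ?_
    rw [Finset.sum_const, nsmul_eq_mul]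
    split_ifs
    · gcongr
      exact h.card_neighbours_le hd hi
    · simp
  have h2 : ∑ i ∈ M.nodes, ∑ j ∈ M.nodes with M.IsEdge i j, (if j ∈ T then D else 0) =
      ∑ i ∈ M.nodes, ∑ j ∈ M.nodes with M.IsEdge i j, (if i ∈ T then D else 0) := by
    simp only [Finset.sum_filter]
    rw [Finset.sum_comm]
    refine Finset.sum_congr rfl fun i _ => Finset.sum_congr rfl fun j _ => ?_
    simp only [show M.IsEdge j i ↔ M.IsEdge i j from ⟨IsEdge.symm, IsEdge.symm⟩]
  simp only [Finset.sum_add_distrib]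
  rw [h2]
  linarith

/-- Passing from a multiple of the integral to a multiple of the average. -/
theorem integral_le_average {T : Finset (Rd d)} (hT : T ∈ M.simplices) {P : Set (Rd d)}
    (hTP : hull T ⊆ P) (hPs : P ⊆ M.complex.space) {C₁ C₂ : ℝ} (hC₁ : 0 ≤ C₁)
    (hvol : volume.real P ≤ C₂ * volume.real (hull T)) (v : Rd d → Rd d) :
    C₁ / volume.real (hull T) * ∫ y in P, ‖v y‖ ≤ C₁ * C₂ * ⨍ y in P, ‖v y‖ := by
  have hV := (isSimplex hT).volume_hull_pos
  have hfin : volume P ≠ ⊤ := ((measure_mono hPs).trans_lt isCompact_space.measure_lt_top).ne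
  have hVP : 0 < volume.real P := hV.trans_le (measureReal_mono hTP hfin)
  have hI : 0 ≤ ∫ y in P, ‖v y‖ := integral_nonneg fun _ => norm_nonneg _
  rw [setAverage_eq, smul_eq_mul]
  have h1 : 1 / volume.real (hull T) ≤ C₂ * (volume.real P)⁻¹ := by
    rw [← div_eq_mul_inv, div_le_div_iff₀ hV hVP, one_mul]
    exact hvol
  calc C₁ / volume.real (hull T) * ∫ y in P, ‖v y‖
      = C₁ * (1 / volume.real (hull T)) * ∫ y in P, ‖v y‖ := by ring
    _ ≤ C₁ * (C₂ * (volume.real P)⁻¹) * ∫ y in P, ‖v y‖ := by gcongr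
    _ = _ := by ring

theorem omega0_subset_space (A : Set (Rd d)) : M.omega0 A ⊆ M.complex.space :=
  iUnion₂_subset fun _ hT => hull_subset_space hT.1

theorem omega1_subset_space (A : Set (Rd d)) : M.omega1 A ⊆ M.complex.space :=
  iUnion₂_subset fun _ hT => hull_subset_space hT.1

theorem hull_subset_omega0 {T T' : Finset (Rd d)} (hT : T ∈ M.simplices) (hT' : T' ∈ M.simplices)
    {k : Rd d} (hk : k ∈ T) (hk' : k ∈ T') : hull T' ⊆ M.omega0 (hull T) :=
  subset_biUnion_of_mem (u := hull)
    (show T' ∈ {S ∈ M.simplices | ∃ j ∈ M.nodes, j ∈ hull T ∩ hull S} from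
      ⟨hT', k, mem_nodes_iff.2 ⟨T, hT, hk⟩, mem_hull hk, mem_hull hk'⟩)

theorem hull_subset_omega1 {T T' : Finset (Rd d)} (hT : T ∈ M.simplices) (hT' : T' ∈ M.simplices)
    {i j : Rd d} (hij : i ≠ j) (hi : i ∈ T) (hj : j ∈ T) (hi' : i ∈ T') (hj' : j ∈ T') :
    hull T' ⊆ M.omega1 (hull T) :=
  subset_biUnion_of_mem (u := hull)
    (show T' ∈ {S ∈ M.simplices | ∃ i j, M.IsEdge i j ∧ segment ℝ i j ⊆ hull T ∩ hull S} from
      ⟨hT', i, j, isEdge_iff.2 ⟨hij, T, hT, hi, hj⟩, subset_inter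
        ((convex_hull T).segment_subset (mem_hull hi) (mem_hull hj))
        ((convex_hull T').segment_subset (mem_hull hi') (mem_hull hj'))⟩)

/-- A union of simplices that meet `T` in a vertex and are not much larger than `T` has comparable
volume. -/
theorem ShapeRegular.volume_patch_le (h : M.ShapeRegular κ) (hd : 1 ≤ d) {T : Finset (Rd d)}
    (hT : T ∈ M.simplices) {P : Set (Rd d)} {Q : ℝ} (hQ : 0 ≤ Q)
    (hP : ∀ y ∈ P, ∃ T' : Finset (Rd d), y ∈ hull T' ∧ (∃ k, k ∈ T ∧ k ∈ T') ∧
      Metric.diam (hull T') ≤ Q * Metric.diam (hull T)) :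
    volume.real P ≤ ((1 + Q) * κ) ^ d * volume.real (hull T) := by
  obtain ⟨x₀, hx₀⟩ : T.Nonempty := Finset.card_pos.1 (by rw [hT.2]; omega)
  -- The factor `1 + Q` comes from the path from `x₀` through `T` to the shared vertex, and from
  -- there through `T'`.
  refine h.volume_le hd hT (x₀ := x₀) (by positivity) fun y hy => ?_
  obtain ⟨T', hyT', ⟨k, hk, hk'⟩, hdiam⟩ := hP y hy
  rw [Metric.mem_closedBall]
  have h1 : dist y k ≤ Metric.diam (hull T') := by
    rw [dist_eq_norm]; exact norm_sub_le_diam hyT' (mem_hull hk')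
  have h2 : dist k x₀ ≤ Metric.diam (hull T) := by
    rw [dist_eq_norm]; exact norm_sub_le_diam (mem_hull hk) (mem_hull hx₀)
  linarith [dist_triangle y k x₀]

open Classical in
theorem norm_pi2_le (m : Rd d → Rd d → Rd d) (v : Rd d → Rd d) (x : Rd d) {D : ℝ}
    {T : Finset (Rd d)}
    (hterm : ∀ i j, M.IsEdge i j → ‖((-M.coef v i j) • M.psi m j i) x‖ ≤
      (if i ∈ T then D else 0) + (if j ∈ T then D else 0)) :
    ‖M.Pi2 m v x‖ ≤ ∑ i ∈ M.nodes, ∑ j ∈ M.nodes with M.IsEdge i j,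
      ((if i ∈ T then D else 0) + (if j ∈ T then D else 0)) := by
  rw [pi2_eq, Finset.sum_apply]
  refine (norm_sum_le _ _).trans (Finset.sum_le_sum fun i _ => ?_)
  rw [Finset.sum_apply]
  exact (norm_sum_le _ _).trans (Finset.sum_le_sum fun j hj =>
    hterm i j (Finset.mem_filter.1 hj).2)

/-- The constant in the local stability estimate, in terms of a bound `Q` for the ratios of the
diameters of neighbouring simplices. -/
def stabilityConst (d : ℕ) (κ Q : ℝ) : ℝ :=
  2 * ((d + 1) * ((d + 1) * κ ^ d * (2 * (d + 1) * (d + 2) * κ * (Q * κ)))) * ((1 + Q) * κ) ^ d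

/-- Local stability on a patch. -/
theorem ShapeRegular.eLpNorm_pi2_le (h : M.ShapeRegular κ) (hd : 1 ≤ d) (m : Rd d → Rd d → Rd d)
    {v : Rd d → Rd d} (hv : IntegrableOn v M.domain) {T : Finset (Rd d)} (hT : T ∈ M.simplices)
    {P : Set (Rd d)} {Q : ℝ} (hQ : 0 ≤ Q) (hTP : hull T ⊆ P) (hPs : P ⊆ M.complex.space)
    (hP : ∀ y ∈ P, ∃ T' : Finset (Rd d), y ∈ hull T' ∧ (∃ k, k ∈ T ∧ k ∈ T') ∧
      Metric.diam (hull T') ≤ Q * Metric.diam (hull T))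
    (hpsi : ∀ i j, M.IsEdge i j → (∀ x ∈ hull T, M.psi m j i x = 0) ∨
      ((i ∈ T ∨ j ∈ T) ∧ M.edgePatch i j ⊆ P ∧ Metric.diam (hull T) ≤ Q * κ * ‖j - i‖)) :
    eLpNorm (M.Pi2 m v) ⊤ (volume.restrict (hull T)) ≤
      ENNReal.ofReal (stabilityConst d κ Q * ⨍ x in P, ‖v x‖) := by
  classical
  have hκ := h.one_le hd hT
  have hV := (isSimplex hT).volume_hull_pos
  have hI : 0 ≤ ∫ y in P, ‖v y‖ := integral_nonneg fun _ => norm_nonneg _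
  rw [eLpNorm_exponent_top]
  refine eLpNormEssSup_le_of_ae_bound ((ae_restrict_iff' (isClosed_hull T).measurableSet).2
    (ae_of_all _ fun x hx => ?_))
  set D := 2 * (d + 1) * (d + 2) * κ * (Q * κ) / volume.real (hull T) * ∫ y in P, ‖v y‖ with hD
  have hD0 : 0 ≤ D := by positivity
  have hterm : ∀ i j, M.IsEdge i j → ‖((-M.coef v i j) • M.psi m j i) x‖ ≤
      (if i ∈ T then D else 0) + (if j ∈ T then D else 0) := by
    intro i j hij
    rcases hpsi i j hij with h0 | ⟨hmem, hsub, hdiam⟩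
    · rw [Pi.smul_apply, h0 x hx, smul_zero, norm_zero]
      positivity
    · have h1 := h.norm_term_le hd m hv hT hx hij hsub hPs hdiam
      refine h1.trans ?_
      change D ≤ _
      rcases hmem with hi | hj
      · rw [if_pos hi]
        exact le_add_of_nonneg_right (by positivity)
      · rw [if_pos hj]
        exact le_add_of_nonneg_left (by positivity)
  refine (norm_pi2_le m v x hterm).trans ((h.sum_edges_le hd hT hD0).trans ?_)
  have h2 := integral_le_average hT hTP hPs
    (C₁ := 2 * ((d + 1) * ((d + 1) * κ ^ d * (2 * (d + 1) * (d + 2) * κ * (Q * κ)))))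
    (by positivity) (h.volume_patch_le hd hT hQ hP) v
  refine le_trans (le_of_eq ?_) h2
  rw [hD]
  ring

/-- A contributing edge has at least one vertex in `T`, so every simplex containing that edge lies
in the star of a vertex of `T`. `diam_le_of_star` controls both the volume of the patch and the
length of the edge. -/
theorem ShapeRegular.stability_omega0 (h : M.ShapeRegular κ) (hd : 2 ≤ d)
    (hB : M.BoundaryLocallyConnected) (m : Rd d → Rd d → Rd d)
    {v : Rd d → Rd d} (hv : IntegrableOn v M.domain) {T : Finset (Rd d)}
    (hT : T ∈ M.simplices) :
    eLpNorm (M.Pi2 m v) ⊤ (volume.restrict (hull T)) ≤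
      ENNReal.ofReal (stabilityConst d κ (diamRatio d κ) * ⨍ x in M.omega0 (hull T), ‖v x‖) := by
  have hκ := h.one_le (by omega) hT
  have hQ : 0 ≤ diamRatio d κ := by unfold diamRatio; positivity
  obtain ⟨k₀, hk₀⟩ : T.Nonempty := Finset.card_pos.1 (by rw [hT.2]; omega)
  refine h.eLpNorm_pi2_le (by omega) m hv hT hQ (hull_subset_omega0 hT hT hk₀ hk₀)
    (omega0_subset_space _) ?_ ?_
  · intro y hy
    obtain ⟨T', ⟨hT', k, hk, hkT, hkT'⟩, hyT'⟩ := mem_iUnion₂.1 hy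
    have h1 := mem_of_mem_hull hk hT hkT
    have h2 := mem_of_mem_hull hk hT' hkT'
    exact ⟨T', hyT', ⟨k, h1, h2⟩,
      h.diam_le_of_star hd hB (mem_star.2 ⟨hT, h1⟩) (mem_star.2 ⟨hT', h2⟩)⟩
  · intro i j hij
    by_cases hmem : i ∈ T ∨ j ∈ T
    · right
      have hcomm : ∀ S ∈ M.simplices, i ∈ S → j ∈ S → ∃ k, k ∈ T ∧ k ∈ S := by
        intro S _ hi hj
        rcases hmem with h1 | h1
        · exact ⟨i, h1, hi⟩
        · exact ⟨j, h1, hj⟩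
      refine ⟨hmem, iUnion₂_subset fun S hS => ?_, ?_⟩
      · obtain ⟨k, hk, hkS⟩ := hcomm S hS.1 hS.2.1 hS.2.2
        exact hull_subset_omega0 hT hS.1 hk hkS
      · obtain ⟨hne, S, hS, hi, hj⟩ := isEdge_iff.1 hij
        obtain ⟨k, hk, hkS⟩ := hcomm S hS hi hj
        calc Metric.diam (hull T) ≤ diamRatio d κ * Metric.diam (hull S) :=
              h.diam_le_of_star hd hB (mem_star.2 ⟨hS, hkS⟩) (mem_star.2 ⟨hT, hk⟩)
          _ ≤ diamRatio d κ * (κ * ‖j - i‖) := by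
              gcongr
              exact h.diam_le_edge (by omega) hS hi hj hne
          _ = _ := by ring
    · push Not at hmem
      exact Or.inl fun x hx => psi_eq_zero hT hx hmem.2 hmem.1

/-- Boundary edges have no vertex in `T`, so their modified bubbles vanish there, and every other
contributing edge lies in `T`. Sharing an edge already gives the ratio `κ`, so no connectedness at
vertices is needed. -/
theorem ShapeRegular.stability_omega1 (h : M.ShapeRegular κ) (hd : 1 ≤ d)
    (m : Rd d → Rd d → Rd d) {v : Rd d → Rd d} (hv : IntegrableOn v M.domain)
    {T : Finset (Rd d)} (hT : T ∈ M.simplices) (hfr : hull T ∩ frontier M.domain = ∅) :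
    eLpNorm (M.Pi2 m v) ⊤ (volume.restrict (hull T)) ≤
      ENNReal.ofReal (stabilityConst d κ κ * ⨍ x in M.omega1 (hull T), ‖v x‖) := by
  have hκ := h.one_le hd hT
  obtain ⟨k₀, hk₀⟩ : T.Nonempty := Finset.card_pos.1 (by rw [hT.2]; omega)
  obtain ⟨l₀, hl₀, hne₀⟩ := (isSimplex hT).exists_ne_mem hd k₀
  refine h.eLpNorm_pi2_le hd m hv hT (by linarith)
    (hull_subset_omega1 hT hT hne₀ hl₀ hk₀ hl₀ hk₀) (omega1_subset_space _) ?_ ?_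
  · intro y hy
    obtain ⟨T', ⟨hT', i, j, hij, hseg⟩, hyT'⟩ := mem_iUnion₂.1 hy
    have hi := hseg (left_mem_segment ℝ i j)
    have hj := hseg (right_mem_segment ℝ i j)
    refine ⟨T', hyT', ⟨i, mem_of_mem_hull hij.left_mem hT hi.1,
      mem_of_mem_hull hij.left_mem hT' hi.2⟩, ?_⟩
    refine (h.diam_le_edge hd hT' (mem_of_mem_hull hij.left_mem hT' hi.2)
      (mem_of_mem_hull hij.right_mem hT' hj.2) hij.ne).trans ?_
    gcongr
    exact norm_sub_le_diam hj.1 hi.1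
  · intro i j hij
    by_cases hmem : i ∈ T ∧ j ∈ T
    · right
      refine ⟨Or.inl hmem.1, iUnion₂_subset fun S hS => hull_subset_omega1 hT hS.1 hij.ne
        hmem.1 hmem.2 hS.2.1 hS.2.2, ?_⟩
      refine (h.diam_le_edge hd hT hmem.1 hmem.2 hij.ne).trans ?_
      gcongr
      nlinarith
    · left
      intro x hx
      by_cases hbd : M.IsBoundaryEdge j i
      · have hnot : ∀ k ∈ segment ℝ j i, k ∉ T := fun k hk hkT =>
          (hfr ▸ (⟨mem_hull hkT, hbd.2 hk⟩ : k ∈ hull T ∩ frontier M.domain) : k ∈ (∅ : Set _))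
        exact psi_eq_zero hT hx (hnot j (left_mem_segment ℝ j i))
          (hnot i (right_mem_segment ℝ j i))
      · rw [psi, if_neg hbd]
        exact b_eq_zero hT hx fun hc => hmem ⟨hc.2, hc.1⟩

theorem pi2_add {m : Rd d → Rd d → Rd d} {v w : Rd d → Rd d} (hv : IntegrableOn v M.domain)
    (hw : IntegrableOn w M.domain) : M.Pi2 m (v + w) = M.Pi2 m v + M.Pi2 m w := by
  classical
  simp only [pi2_eq, coef_add hv hw, neg_add, add_smul, Finset.sum_add_distrib]

theorem pi2_smul (m : Rd d → Rd d → Rd d) (c : ℝ) (v : Rd d → Rd d) :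
    M.Pi2 m (c • v) = c • M.Pi2 m v := by
  classical
  simp only [pi2_eq, coef_smul, ← mul_neg, mul_smul, Finset.smul_sum]

theorem pi2_congr (m : Rd d → Rd d → Rd d) {v w : Rd d → Rd d}
    (h : v =ᵐ[volume.restrict M.domain] w) : M.Pi2 m v = M.Pi2 m w := by
  classical
  simp only [pi2_eq, coef_congr h]

end Mesh

end Fortin

end

theorem mainTheorem4 (d : ℕ) (hd : 2 ≤ d) :
    -- the operator is well defined and linear on `L¹`, has values in the span of the interior
    -- tangential bubbles, and preserves the discrete divergence
    (∀ M : Fortin.Mesh d, M.HasInteriorNodes →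
      (∃ m, M.IsChoice m) ∧
      ∀ m, M.IsChoice m →
        (∀ v, IntegrableOn v M.domain → M.Pi2 m v ∈ M.edgeSpace) ∧
        (∀ v w, IntegrableOn v M.domain → IntegrableOn w M.domain →
          v =ᵐ[volume.restrict M.domain] w → M.Pi2 m v = M.Pi2 m w) ∧
        (∀ v w, IntegrableOn v M.domain → IntegrableOn w M.domain →
          M.Pi2 m (v + w) = M.Pi2 m v + M.Pi2 m w) ∧
        (∀ (c : ℝ) (v), IntegrableOn v M.domain → M.Pi2 m (c • v) = c • M.Pi2 m v) ∧
        (∀ v G, Fortin.MemW110 M.domain v G →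
          ∃ H, Fortin.MemW11 M.domain (M.Pi2 m v) H ∧
            ∀ k ∈ M.nodes, ∫ x in M.domain, Fortin.divOf H x * M.phi k x =
              ∫ x in M.domain, Fortin.divOf G x * M.phi k x)) ∧
    -- local stability, with a constant that depends only on `d` and the shape regularity
    (∀ κ : ℝ, ∃ C : ℝ, 0 < C ∧
      ∀ M : Fortin.Mesh d, M.HasInteriorNodes → M.ShapeRegular κ →
      ∀ m, M.IsChoice m → ∀ v, IntegrableOn v M.domain → ∀ T ∈ M.simplices,
        (M.BoundaryLocallyConnected →
          eLpNorm (M.Pi2 m v) ∞ (volume.restrict (Fortin.Mesh.hull T)) ≤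
            ENNReal.ofReal (C * ⨍ x in M.omega0 (Fortin.Mesh.hull T), ‖v x‖)) ∧
        (Fortin.Mesh.hull T ∩ frontier M.domain = ∅ →
          eLpNorm (M.Pi2 m v) ∞ (volume.restrict (Fortin.Mesh.hull T)) ≤
            ENNReal.ofReal (C * ⨍ x in M.omega1 (Fortin.Mesh.hull T), ‖v x‖))) := by

  refine ⟨fun M hM => ⟨Fortin.Mesh.exists_isChoice hM, fun m hm =>
    ⟨fun v _ => Fortin.Mesh.pi2_mem_edgeSpace hm v, fun v w _ _ h => Fortin.Mesh.pi2_congr m h,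
      fun v w hv hw => Fortin.Mesh.pi2_add hv hw, fun c v _ => Fortin.Mesh.pi2_smul m c v,
      fun v G hv => Fortin.Mesh.pi2_divergence hm hv⟩⟩, fun κ => ?_⟩
  -- One constant dominates both estimates; the absolute values and the 1 keep it positive for every
  -- real `κ`, even where no simplex satisfies the bound.
  refine ⟨1 + |Fortin.Mesh.stabilityConst d κ (Fortin.Mesh.diamRatio d κ)| +
    |Fortin.Mesh.stabilityConst d κ κ|, by positivity,
    fun M _ hκ m _ v hv T hT => ⟨fun hB => ?_, fun hfr => ?_⟩⟩
  · refine (hκ.stability_omega0 hd hB m hv hT).trans (ENNReal.ofReal_le_ofReal ?_)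
    refine mul_le_mul_of_nonneg_right ?_ (integral_nonneg fun _ => norm_nonneg _)
    linarith [le_abs_self (Fortin.Mesh.stabilityConst d κ (Fortin.Mesh.diamRatio d κ)),
      abs_nonneg (Fortin.Mesh.stabilityConst d κ κ)]
  · refine (hκ.stability_omega1 (by omega) m hv hT hfr).trans (ENNReal.ofReal_le_ofReal ?_)
    refine mul_le_mul_of_nonneg_right ?_ (integral_nonneg fun _ => norm_nonneg _)
    linarith [abs_nonneg (Fortin.Mesh.stabilityConst d κ (Fortin.Mesh.diamRatio d κ)),
      le_abs_self (Fortin.Mesh.stabilityConst d κ κ)]
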